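/- Let $q\in\{2,3,4\}$ and let $F_q$ be the function field of the elliptic curve $X_q$ over $\mathbf F_q$ with affine equation $$y^2+y=x^3+x+1\ (q=2),\qquad y^2=x^3-x-1\ (q=3),\qquad y^2+y=x^3+\alpha,\ \mathbf F_4=\mathbf F_2(\alpha)\ (q=4).$$ Let $\mathbf A$ be the adele ring of $F_q$, $\mathcal O_{\mathbf A}$ its ring of integral adeles, $K=\mathrm{GL}_2(\mathcal O_{\mathbf A})$, and let $Z_{\mathbf A}$ be the center of $\mathrm{GL}_2(\mathbf A)$. An unramified automorphic form is a function $f:\mathrm{GL}_2(F_q)\backslash \mathrm{GL}_2(\mathbf A)/KZ_{\mathbf A}\to\mathbf C$; it is a cusp form if $\int_{F_q\backslash\mathbf A} f\big(\begin{pmatrix}1&x\\0&1\end{pmatrix}g\big)\,dx=0$ for all $g\in \mathrm{GL}_2(\mathbf A)$. The Hecke algebra $\mathcal H=C_0^\infty(K\backslash \mathrm{GL}_2(\mathbf A)/K)$ acts on unramified automorphic forms by $\Phi(f)(g)=\int_{\mathrm{GL}_2(\mathbf A)}\Phi(h)f(gh)\,dh$; $f$ is a simultaneous $\mathcal H$-eigenform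 if for every $\Phi\in\mathcal H$ there is $\lambda_\Phi\in\mathbf C$ with $\Phi(f)=\lambda_\Phi f$. Let $\infty$ be the place of $F_q$ at which $x$ has a pole, and $t=x/y$. For $\ell\in\mathbf F_q$ let $t_\ell\in\mathrm{GL}_2(\mathbf A)$ be the element with component $\begin{pmatrix}t^2&t^{-1}+\ell t\\0&1\end{pmatrix}$ at $\infty$ and the identity matrix at all other places. Then, for an unramified automorphic form $f$, the following are equivalent: (i) $f$ is a cusp form, is a simultaneous $\mathcal H$-eigenform, and vanishes outside the union of the double cosets $\mathrm{GL}_2(F_q)\,t_\ell\,KZ_{\mathbf A}$, $\ell\in\mathbf F_q$; (ii) $f=0$. -/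

import Mathlib

open scoped Polynomial RestrictedProduct

noncomputable section

namespace AutomorphicGL2

/-! ### Affine matrices -/

/-- The matrix `(a, b; 0, 1)` in `GL₂(R)`. -/
def affineMatrix {R : Type*} [CommRing R] (a : Rˣ) (b : R) : GL (Fin 2) R where
  val := !![(a : R), b; 0, 1]
  inv := !![((a⁻¹ : Rˣ) : R), -(((a⁻¹ : Rˣ) : R) * b); 0, 1]
  val_inv := by
    ext i j; fin_cases i <;> fin_cases j <;> simp
  inv_val := by
    ext i j; fin_cases i <;> fin_cases j <;> simp

theorem affineMatrix_one_mul {R : Type*} [CommRing R] (b c : R) :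
    affineMatrix 1 b * affineMatrix 1 c = affineMatrix 1 (b + c) := by
  ext i j; fin_cases i <;> fin_cases j <;> simp [affineMatrix, add_comm]

theorem map_affineMatrix_one {R S : Type*} [CommRing R] [CommRing S] (φ : R →+* S) (b : R) :
    Matrix.GeneralLinearGroup.map φ (affineMatrix 1 b) = affineMatrix 1 (φ b) := by
  ext i j; fin_cases i <;> fin_cases j <;> simp [affineMatrix]

/-! ### Places, adeles and the adelic group -/

section Adelic

variable (k F : Type*) [Field k] [Field F] [Algebra k F]

/-- A place of a function field `F` over `k`: a valuation ring `𝒪` of `F` with `k ⊆ 𝒪 ⊊ F`. -/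
@[ext]
structure Place where
  ring : ValuationSubring F
  algebraMap_mem : ∀ a : k, algebraMap k F a ∈ ring
  ne_top : ring ≠ ⊤

variable {k F}

/-- The completion `F_v` of `F` at the place `v`. -/
abbrev Place.Completion (v : Place k F) : Type _ := v.ring.valuation.Completion

/-- The ring of integers `𝒪_v` of `F_v`. -/
abbrev Place.integers (v : Place k F) : Subring v.Completion := Valued.integer v.Completion

/-- The embedding of `F` in its completion `F_v`. -/
def Place.embed (v : Place k F) : F →+* v.Completion :=
  UniformSpace.Completion.coeRingHom.comp
    ((WithVal.equiv v.ring.valuation).symm : F →+* WithVal v.ring.valuation)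

variable (k F)

/-- The adele ring of `F`: the restricted product of the `F_v` with respect to the `𝒪_v`, over all
places `v`, with its restricted product topology. -/
abbrev Adele : Type _ := Πʳ v : Place k F, [v.Completion, v.integers]

variable {k F}

/-- The projection of the adele ring to its component at `v`. -/
def component (v : Place k F) : Adele k F →+* v.Completion :=
  RestrictedProduct.evalRingHom (fun v : Place k F => v.Completion) v

variable (k F)

/-- The ring `𝒪_𝔸` of integral adeles. -/
def integralAdeles : Subring (Adele k F) := ⨅ v : Place k F, v.integers.comap (component v)

/-- The field `F`, diagonally embedded in its adele ring: the adeles all of whose components are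
equal to one and the same element of `F`. -/
def principalAdeles : AddSubgroup (Adele k F) where
  carrier := {a | ∃ x : F, ∀ v : Place k F, component v a = v.embed x}
  zero_mem' := ⟨0, fun v => by simp⟩
  add_mem' := by
    rintro a b ⟨x, hx⟩ ⟨y, hy⟩
    exact ⟨x + y, fun v => by simp [hx, hy]⟩
  neg_mem' := by
    rintro a ⟨x, hx⟩
    exact ⟨-x, fun v => by simp [hx]⟩

/-- The group `G_𝔸 = GL₂(𝔸)`. -/
abbrev AdelicGL2 : Type _ := GL (Fin 2) (Adele k F)

/-- The group `G_F = GL₂(F)`, diagonally embedded in `GL₂(𝔸)`: the adelic matrices all of whose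
components are equal to one and the same element of `GL₂(F)`. -/
def principalGL2 : Subgroup (AdelicGL2 k F) where
  carrier := {g | ∃ γ : GL (Fin 2) F, ∀ v : Place k F,
    Matrix.GeneralLinearGroup.map (component v) g = Matrix.GeneralLinearGroup.map v.embed γ}
  one_mem' := ⟨1, fun v => by simp⟩
  mul_mem' := by
    rintro a b ⟨x, hx⟩ ⟨y, hy⟩
    exact ⟨x * y, fun v => by simp only [map_mul, hx, hy]⟩
  inv_mem' := by
    rintro a ⟨x, hx⟩
    exact ⟨x⁻¹, fun v => by simp only [map_inv, hx]⟩

/-- The maximal compact subgroup `K = GL₂(𝒪_𝔸)` of `GL₂(𝔸)`. -/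
def maxCompact : Subgroup (AdelicGL2 k F) :=
  (Matrix.GeneralLinearGroup.map (n := Fin 2) (integralAdeles k F).subtype).range

/-- The center `Z_𝔸` of `GL₂(𝔸)`, that is, the group of scalar matrices. -/
def adelicCenter : Subgroup (AdelicGL2 k F) :=
  (Matrix.GeneralLinearGroup.scalar (Fin 2) : (Adele k F)ˣ →* AdelicGL2 k F).range

/-! ### Unramified automorphic forms, cusp forms, Hecke eigenforms -/

/-- The space of unramified automorphic forms `f : G_F \ G_𝔸 / K Z_𝔸 → ℂ`. -/
def UnramifiedForms : Submodule ℂ (AdelicGL2 k F → ℂ) where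
  carrier := {f | (∀ γ ∈ principalGL2 k F, ∀ g, f (γ * g) = f g) ∧
    (∀ κ ∈ maxCompact k F, ∀ g, f (g * κ) = f g) ∧
    (∀ z ∈ adelicCenter k F, ∀ g, f (g * z) = f g)}
  zero_mem' := by simp
  add_mem' := by
    rintro f f' ⟨h1, h2, h3⟩ ⟨h1', h2', h3'⟩
    refine ⟨fun γ hγ g => ?_, fun κ hκ g => ?_, fun z hz g => ?_⟩
    · simp only [Pi.add_apply, h1 γ hγ, h1' γ hγ]
    · simp only [Pi.add_apply, h2 κ hκ, h2' κ hκ]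
    · simp only [Pi.add_apply, h3 z hz, h3' z hz]
  smul_mem' := by
    rintro c f ⟨h1, h2, h3⟩
    refine ⟨fun γ hγ g => ?_, fun κ hκ g => ?_, fun z hz g => ?_⟩
    · simp only [Pi.smul_apply, h1 γ hγ]
    · simp only [Pi.smul_apply, h2 κ hκ]
    · simp only [Pi.smul_apply, h3 z hz]

/-- The compact quotient `F \ 𝔸`, with the quotient topology. -/
abbrev AdeleQuotient : Type _ := Adele k F ⧸ principalAdeles k F

/-- `F \ 𝔸` carries its Borel σ-algebra. -/
instance : MeasurableSpace (AdeleQuotient k F) := borel _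

variable {k F}

theorem affineMatrix_mem_principalGL2 {p : Adele k F} (hp : p ∈ principalAdeles k F) :
    affineMatrix 1 p ∈ principalGL2 k F := by
  obtain ⟨x, hx⟩ := hp
  exact ⟨affineMatrix 1 x, fun v => by rw [map_affineMatrix_one, map_affineMatrix_one, hx]⟩

/-- The function `x ↦ f((1, x; 0, 1) g)` on `F \ 𝔸`. -/
def unipotentTranslate (f : UnramifiedForms k F) (g : AdelicGL2 k F) :
    AdeleQuotient k F → ℂ :=
  fun c => Quotient.liftOn' c (fun x => f.1 (affineMatrix 1 x * g)) (by
    intro a b hab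
    have hp : -a + b ∈ principalAdeles k F := QuotientAddGroup.leftRel_apply.mp hab
    have h := f.2.1 _ (affineMatrix_mem_principalGL2 hp) (affineMatrix 1 a * g)
    rw [← mul_assoc, affineMatrix_one_mul, neg_add_cancel_comm] at h
    exact h.symm)

/-- An unramified automorphic form `f` is a cusp form if `∫_{F \ 𝔸} f((1, x; 0, 1) g) dx = 0` for
all `g` in `GL₂(𝔸)`, where `dx` is a Haar measure. -/
def IsCuspForm (f : UnramifiedForms k F) : Prop :=
  ∀ (μ : MeasureTheory.Measure (AdeleQuotient k F)) [μ.IsAddHaarMeasure] (g : AdelicGL2 k F),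
    ∫ x, unipotentTranslate f g x ∂μ = 0

variable (k F)

/-- The Hecke algebra `ℋ = C₀^∞(K \ G_𝔸 / K)`: the bi-`K`-invariant functions on `GL₂(𝔸)` whose
support is a finite union of cosets `h K`. Since `K` is compact and open, these are the same as the
bi-`K`-invariant functions that are locally constant and have compact support. -/
def HeckeAlgebra : Submodule ℂ (AdelicGL2 k F → ℂ) where
  carrier := {Φ | (∀ κ ∈ maxCompact k F, ∀ g, Φ (κ * g) = Φ g) ∧
    (∀ κ ∈ maxCompact k F, ∀ g, Φ (g * κ) = Φ g) ∧
    (Set.image (QuotientGroup.mk : AdelicGL2 k F → AdelicGL2 k F ⧸ maxCompact k F)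
      (Function.support Φ)).Finite}
  zero_mem' := by simp
  add_mem' := by
    rintro f f' ⟨h1, h2, h3⟩ ⟨h1', h2', h3'⟩
    refine ⟨fun κ hκ g => ?_, fun κ hκ g => ?_, ?_⟩
    · simp only [Pi.add_apply, h1 κ hκ, h1' κ hκ]
    · simp only [Pi.add_apply, h2 κ hκ, h2' κ hκ]
    · refine (h3.union h3').subset ?_
      rw [← Set.image_union]
      exact Set.image_mono (Function.support_add f f')
  smul_mem' := by
    rintro c f ⟨h1, h2, h3⟩
    refine ⟨fun κ hκ g => ?_, fun κ hκ g => ?_, ?_⟩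
    · simp only [Pi.smul_apply, h1 κ hκ]
    · simp only [Pi.smul_apply, h2 κ hκ]
    · exact h3.subset (Set.image_mono (Function.support_const_smul_subset c f))

variable {k F}

/-- The action of the Hecke algebra by convolution,
`Φ(f)(g) = ∫_{G_𝔸} Φ(h) f(g h) dh`, where `dh` is the Haar measure that gives `K` the volume `1`:
as the integrand is constant on the cosets `h K`, and non-zero on finitely many of them only, the
integral is the sum of its values over `G_𝔸 / K`. -/
def heckeAction (Φ : HeckeAlgebra k F) (f : UnramifiedForms k F) (g : AdelicGL2 k F) : ℂ :=
  ∑ᶠ c : AdelicGL2 k F ⧸ maxCompact k F,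
    Quotient.liftOn' c (fun h => Φ.1 h * f.1 (g * h)) (by
      intro a b hab
      have hκ : a⁻¹ * b ∈ maxCompact k F := QuotientGroup.leftRel_apply.mp hab
      have h1 := Φ.2.2.1 _ hκ a
      have h2 := f.2.2.1 _ hκ (g * a)
      rw [mul_inv_cancel_left] at h1
      rw [mul_assoc, mul_inv_cancel_left] at h2
      change Φ.1 a * f.1 (g * a) = Φ.1 b * f.1 (g * b)
      rw [h1, h2])

/-- `f` is a simultaneous eigenform: it is multiplied by a scalar by every element of the Hecke
algebra. -/
def IsHeckeEigenform (f : UnramifiedForms k F) : Prop :=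
  ∀ Φ : HeckeAlgebra k F, ∃ c : ℂ, ∀ g, heckeAction Φ f g = c * f.1 g

/-- `g` and `h` represent the same element of `G_F \ G_𝔸 / K Z_𝔸`. -/
def SameDoubleCoset (g h : AdelicGL2 k F) : Prop :=
  ∃ γ ∈ principalGL2 k F, ∃ κ ∈ maxCompact k F, ∃ z ∈ adelicCenter k F, g = γ * h * κ * z

/-! ### Adelic matrices concentrated at one place -/

open scoped Classical in
/-- The idele with component `a` at `v`, and `1` at all other places. -/
def localIdele (v : Place k F) (a : v.Completionˣ) : (Adele k F)ˣ where
  val := RestrictedProduct.mulSingle (fun v : Place k F => v.integers) v a.val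
  inv := RestrictedProduct.mulSingle (fun v : Place k F => v.integers) v a.inv
  val_inv := by
    rw [← RestrictedProduct.mulSingle_mul, a.val_inv, RestrictedProduct.mulSingle_one]
  inv_val := by
    rw [← RestrictedProduct.mulSingle_mul, a.inv_val, RestrictedProduct.mulSingle_one]

open scoped Classical in
/-- The element of `GL₂(𝔸)` with component `(a, b; 0, 1)` at `v`, and the identity matrix at all
other places, for `a ≠ 0` and `b` in `F`. -/
def localAffineMatrix (v : Place k F) (a : Fˣ) (b : F) : AdelicGL2 k F :=
  affineMatrix (localIdele v (Units.map (v.embed : F →* v.Completion) a))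
    (RestrictedProduct.single (fun v : Place k F => v.integers) v (v.embed b))

end Adelic

/-! ### Function fields of Weierstrass curves -/

section Curve

variable {k : Type*} [Field k] (W : WeierstrassCurve.Affine k)

/-- The function `x` on the curve. -/
def xFun : W.FunctionField :=
  algebraMap W.CoordinateRing W.FunctionField
    (WeierstrassCurve.Affine.CoordinateRing.mk W (Polynomial.C Polynomial.X))

/-- The function `y` on the curve. -/
def yFun : W.FunctionField :=
  algebraMap W.CoordinateRing W.FunctionField
    (WeierstrassCurve.Affine.CoordinateRing.mk W Polynomial.X)

theorem xFun_not_isIntegral : ¬ IsIntegral k (xFun W) := by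
  rintro ⟨p, hp, h⟩
  have hx : xFun W = algebraMap W.CoordinateRing W.FunctionField
      (algebraMap k[X] W.CoordinateRing Polynomial.X) := rfl
  rw [← Polynomial.aeval_def, hx, Polynomial.aeval_algebraMap_apply,
    Polynomial.aeval_algebraMap_apply, Polynomial.aeval_X_left_apply] at h
  have h1 := (injective_iff_map_eq_zero _).mp
    (IsFractionRing.injective W.CoordinateRing W.FunctionField) _ h
  have h2 := (injective_iff_map_eq_zero _).mp
    (FaithfulSMul.algebraMap_injective k[X] W.CoordinateRing) _ h1
  exact hp.ne_zero h2

theorem xFun_ne_zero : xFun W ≠ 0 := fun h =>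
  xFun_not_isIntegral W (h ▸ isIntegral_zero)

theorem yFun_ne_zero : yFun W ≠ 0 := by
  intro h
  have h1 := (injective_iff_map_eq_zero _).mp
    (IsFractionRing.injective W.CoordinateRing W.FunctionField) _ h
  have h2 := WeierstrassCurve.Affine.CoordinateRing.smul_basis_eq_zero (W' := W)
    (p := 0) (q := 1) (by rw [zero_smul, one_smul, zero_add]; exact h1)
  exact one_ne_zero h2.2

theorem exists_place_xFun_notMem : ∃ v : Place k W.FunctionField, xFun W ∉ v.ring := by
  by_contra! hcon
  apply xFun_not_isIntegral W
  have key : xFun W ∈ (⨅ V : {V : ValuationSubring W.FunctionField //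
      ((algebraMap k W.FunctionField).range : Set W.FunctionField) ⊆ V.toSubring},
      V.1.toSubring) := by
    rw [Subring.mem_iInf]
    rintro ⟨V, hV⟩
    by_cases hT : V = ⊤
    · subst hT; exact ValuationSubring.mem_top _
    · exact hcon ⟨V, fun a => hV ⟨a, rfl⟩, hT⟩
  rw [iInf_valuationSubring_superset] at key
  have h : IsIntegral (Subring.closure
      ((algebraMap k W.FunctionField).range : Set W.FunctionField)) (xFun W) := key
  rw [Subring.closure_eq] at h
  obtain ⟨p, hp, hev⟩ := h
  have hsurj : Function.Surjective (algebraMap k W.FunctionField).rangeRestrict :=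
    (algebraMap k W.FunctionField).rangeRestrict_surjective
  obtain ⟨q, hq, -, hqm⟩ := Polynomial.lifts_and_degree_eq_and_monic
    (Polynomial.map_surjective _ hsurj p) hp
  refine ⟨q, hqm, ?_⟩
  rw [← hq, Polynomial.eval₂_map] at hev
  exact hev

/-- The place at infinity of the function field of `W`: the place at which `x` has a pole. (There is
exactly one.) -/
def placeAtInfinity : Place k W.FunctionField := (exists_place_xFun_notMem W).choose

theorem xFun_notMem_placeAtInfinity : xFun W ∉ (placeAtInfinity W).ring :=
  (exists_place_xFun_notMem W).choose_spec

/-- The uniformizer `t = x / y` at infinity. -/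
def tFun : (W.FunctionField)ˣ :=
  Units.mk0 (xFun W) (xFun_ne_zero W) / Units.mk0 (yFun W) (yFun_ne_zero W)

/-- The element `t_ℓ` of `GL₂(𝔸)`, for `ℓ` in `k`: its component at infinity is the matrix
`(t², t⁻¹ + ℓ t; 0, 1)`, and its other components are the identity matrix. -/
def tVertex (l : k) : AdelicGL2 k W.FunctionField :=
  localAffineMatrix (placeAtInfinity W) (tFun W ^ 2)
    (((tFun W)⁻¹ : (W.FunctionField)ˣ) + algebraMap k W.FunctionField l * tFun W)

/-- `f` has support in the set of vertices `{t_ℓ}`. -/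
def SupportedOnT (f : UnramifiedForms k W.FunctionField) : Prop :=
  ∀ g, f.1 g ≠ 0 → ∃ l : k, SameDoubleCoset g (tVertex W l)

/-- The three elliptic curves `y² + y = x³ + x + 1` over `𝔽₂`, `y² = x³ - x - 1` over `𝔽₃`, and
`y² + y = x³ + α` over `𝔽₄ = 𝔽₂(α)`. -/
def IsOneOfThreeCurves : Prop :=
  (Nat.card k = 2 ∧ W = ⟨0, 0, 1, 1, 1⟩) ∨
  (Nat.card k = 3 ∧ W = ⟨0, 0, 0, -1, -1⟩) ∨
  (Nat.card k = 4 ∧ ∃ α : k, α ≠ 0 ∧ α ≠ 1 ∧ W = ⟨0, 0, 1, 0, α⟩)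

end Curve

end AutomorphicGL2

end

/-! The three curves have no affine rational point, and this drives the whole proof. It makes the
coordinate ring `A = k[x, y]` a principal ideal domain (`isPrincipalIdealRing_coordinateRing`), so
the class number is one. Since no element of `A` has pole order one at infinity, it also makes every
`x - ℓ` prime (`prime_xCoord_sub`), with residue field spanned by `1` and `y` over `k`.

Let `P` be the finite place above `x = ℓ`, and apply to `f`, at the identity, the Hecke operator of
the double coset of `(x - ℓ, 0; 0, 1)` at `P`. The cosets involved are indexed by the projective
line over the residue field at `P` (`exists_mem_cosetRepresentatives`). Matrices over the function
field carry these neighbours of the identity from `P` to infinity. The points `c` in `k` and the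
point at infinity become `(t², 0; 0, 1)` (`apply_localAffineMatrix_of_rational`), while the points
`c + d y` with `d ≠ 0` all become `t_ℓ` (`apply_localAffineMatrix_of_irrational`).

Neither the identity nor `(t², 0; 0, 1)` lies in the double coset of any `t_ℓ'`
(`not_sameDoubleCoset_one_tVertex`, `not_sameDoubleCoset_tFun_sq_tVertex`). The reason is again the
missing pole order one: by class number one a coincidence would be realized by a matrix in `GL₂(A)`,
some of whose entries would need a forbidden pole. So a form supported on the `t_ℓ'` vanishes at
both vertices. The eigenvalue equation at the identity then reads `n f(t_ℓ) = 0` with `n > 0`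
(`heckeAction_indicator_one`), whence `f(t_ℓ) = 0` for every `ℓ`. -/

noncomputable section

namespace AutomorphicGL2

/-! ### The affine coordinate ring -/

section CoordinateRing

open WeierstrassCurve.Affine

variable {k : Type*} [Field k] (W : WeierstrassCurve.Affine k)

/-- The function `x` as an element of the affine coordinate ring. -/
def xCoord : W.CoordinateRing := CoordinateRing.mk W (Polynomial.C Polynomial.X)

/-- The function `y` as an element of the affine coordinate ring. -/
def yCoord : W.CoordinateRing := CoordinateRing.mk W Polynomial.X

theorem weierstrass_equation_coord :
    yCoord W ^ 2 + W.a₁ • (xCoord W * yCoord W) + W.a₃ • yCoord W =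
      xCoord W ^ 3 + W.a₂ • xCoord W ^ 2 + W.a₄ • xCoord W +
        algebraMap k W.CoordinateRing W.a₆ := by
  have h : CoordinateRing.mk W (Polynomial.X ^ 2 +
      Polynomial.C (Polynomial.C W.a₁ * Polynomial.X + Polynomial.C W.a₃) * Polynomial.X -
      Polynomial.C (Polynomial.X ^ 3 + Polynomial.C W.a₂ * Polynomial.X ^ 2 +
        Polynomial.C W.a₄ * Polynomial.X + Polynomial.C W.a₆)) = 0 := AdjoinRoot.mk_self
  have hc : ∀ c : k, algebraMap k W.CoordinateRing c =
      CoordinateRing.mk W (Polynomial.C (Polynomial.C c)) := fun _ => rfl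
  simp only [Algebra.smul_def, hc, xCoord, yCoord]
  simp only [map_add, map_mul, map_sub, map_pow] at h ⊢
  linear_combination h

variable {W}

theorem exists_eq_aeval_add (a : W.CoordinateRing) :
    ∃ p q : k[X], a = Polynomial.aeval (xCoord W) p + Polynomial.aeval (xCoord W) q * yCoord W := by
  obtain ⟨p, q, rfl⟩ := CoordinateRing.exists_smul_basis_eq a
  have h : ∀ r : k[X], Polynomial.aeval (xCoord W) r = algebraMap k[X] W.CoordinateRing r := by
    intro r
    have : xCoord W = algebraMap k[X] W.CoordinateRing Polynomial.X := rfl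
    rw [this, Polynomial.aeval_algebraMap_apply, Polynomial.aeval_X_left_apply]
  exact ⟨p, q, by rw [h, h, Algebra.smul_def, Algebra.smul_def, mul_one]; rfl⟩

/-- The order of the pole at infinity of an element of the coordinate ring, with value `⊥` at
`0`. -/
def poleDegree (a : W.CoordinateRing) : WithBot ℕ := (Algebra.norm k[X] a).degree

theorem poleDegree_mul (a b : W.CoordinateRing) :
    poleDegree (a * b) = poleDegree a + poleDegree b := by
  simp only [poleDegree, map_mul, Polynomial.degree_mul]

theorem poleDegree_eq_bot {a : W.CoordinateRing} : poleDegree a = ⊥ ↔ a = 0 := by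
  have : Module.Finite k[X] W.CoordinateRing := .of_basis (CoordinateRing.basis W)
  rw [poleDegree, Polynomial.degree_eq_bot, Algebra.norm_eq_zero_iff]

theorem exists_poleDegree_eq_natCast {a : W.CoordinateRing} (ha : a ≠ 0) :
    ∃ n : ℕ, poleDegree a = n :=
  ⟨_, Polynomial.degree_eq_natDegree fun h =>
    ha (poleDegree_eq_bot.mp (Polynomial.degree_eq_bot.mpr h))⟩

theorem poleDegree_smul_basis (p q : k[X]) :
    poleDegree (p • (1 : W.CoordinateRing) + q • yCoord W) =
      max (2 • p.degree) (2 • q.degree + 3) :=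
  CoordinateRing.degree_norm_smul_basis p q

theorem poleDegree_ne_one (a : W.CoordinateRing) : poleDegree a ≠ 1 :=
  CoordinateRing.degree_norm_ne_one a

theorem two_nsmul_degree_add_lt (p : k[X]) (m n : ℕ) :
    2 • p.degree + m < (n : WithBot ℕ) ↔ ∀ i, n ≤ 2 * i + m → p.coeff i = 0 := by
  rcases eq_or_ne p 0 with rfl | hp
  · simp
  rw [Polynomial.degree_eq_natDegree hp]
  have h2 : 2 • (p.natDegree : WithBot ℕ) + m = ((2 * p.natDegree + m : ℕ) : WithBot ℕ) := by
    push_cast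
    rw [two_nsmul, two_mul]
  rw [h2, Nat.cast_lt]
  refine ⟨fun h i hi => Polynomial.coeff_eq_zero_of_natDegree_lt (by omega), fun h => ?_⟩
  by_contra hn
  exact hp (Polynomial.leadingCoeff_eq_zero.mp (h _ (not_lt.mp hn)))

/-- The monomials `x ^ i` and `x ^ i * y` have the pairwise distinct pole orders `2 * i` and `2 * i
+ 3`, so a bound on the pole order is a condition on single coefficients. -/
theorem poleDegree_smul_basis_lt (p q : k[X]) (n : ℕ) :
    poleDegree (p • (1 : W.CoordinateRing) + q • yCoord W) < n ↔
      (∀ i, n ≤ 2 * i → p.coeff i = 0) ∧ ∀ i, n ≤ 2 * i + 3 → q.coeff i = 0 := by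
  rw [poleDegree_smul_basis, max_lt_iff]
  refine and_congr ?_ (two_nsmul_degree_add_lt q 3 n)
  simpa using two_nsmul_degree_add_lt p 0 n

theorem exists_poleDegree_eq {n : ℕ} (hn : n ≠ 1) : ∃ a : W.CoordinateRing, poleDegree a = n := by
  obtain ⟨m, rfl | rfl⟩ := Nat.even_or_odd' n
  · refine ⟨(Polynomial.X ^ m : k[X]) • (1 : W.CoordinateRing) + (0 : k[X]) • yCoord W, ?_⟩
    rw [poleDegree_smul_basis, Polynomial.degree_X_pow, Polynomial.degree_zero, two_nsmul,
      two_nsmul, WithBot.bot_add, WithBot.bot_add, max_bot_right, two_mul]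
    rfl
  -- For `n = 2 * m + 1` the monomial is `x ^ (m - 1) * y`; the truncated subtraction is harmless
  -- because `n ≠ 1` gives `1 ≤ m`.
  · refine ⟨(0 : k[X]) • (1 : W.CoordinateRing) +
      (Polynomial.X ^ (m - 1) : k[X]) • yCoord W, ?_⟩
    rw [poleDegree_smul_basis, Polynomial.degree_X_pow, Polynomial.degree_zero, two_nsmul,
      two_nsmul, WithBot.bot_add, max_bot_left]
    norm_cast
    omega

/-- Only one basis monomial has pole order `n`, so the leading terms of `a` and `b` are proportional
over `k`: the place at infinity has degree one. The scalar is the quotient of the two coefficients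
at that monomial, whose shape depends on the parity of `n`. -/
theorem exists_poleDegree_sub_lt {a b : W.CoordinateRing} {n : ℕ} (ha : poleDegree a = n)
    (hb : poleDegree b = n) : ∃ c : k, poleDegree (a - c • b) < n := by
  obtain ⟨p, q, rfl⟩ := CoordinateRing.exists_smul_basis_eq a
  obtain ⟨r, s, rfl⟩ := CoordinateRing.exists_smul_basis_eq b
  change poleDegree (p • (1 : W.CoordinateRing) + q • yCoord W) = n at ha
  change poleDegree (r • (1 : W.CoordinateRing) + s • yCoord W) = n at hb
  have ha' : poleDegree (p • (1 : W.CoordinateRing) + q • yCoord W) < (n + 1 : ℕ) := by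
    rw [ha]; exact_mod_cast Nat.lt_succ_self n
  have hb' : poleDegree (r • (1 : W.CoordinateRing) + s • yCoord W) < (n + 1 : ℕ) := by
    rw [hb]; exact_mod_cast Nat.lt_succ_self n
  have hb'' : ¬ poleDegree (r • (1 : W.CoordinateRing) + s • yCoord W) < n := by
    rw [hb]; exact lt_irrefl _
  rw [poleDegree_smul_basis_lt] at ha' hb' hb''
  have key : ∀ c : k,
      poleDegree ((p - c • r) • (1 : W.CoordinateRing) + (q - c • s) • yCoord W) < n →
      poleDegree (p • (1 : W.CoordinateRing) + q • yCoord W -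
        c • (r • (1 : W.CoordinateRing) + s • yCoord W)) < n := by
    intro c hc
    convert hc using 2
    rw [sub_smul, sub_smul, smul_assoc, smul_assoc, smul_add]
    abel
  obtain ⟨m, rfl | rfl⟩ := Nat.even_or_odd' n
  · have hr : r.coeff m ≠ 0 := by
      intro h0
      refine hb'' ⟨fun i hi => ?_, fun i hi => hb'.2 i (by omega)⟩
      rcases eq_or_ne i m with rfl | him
      · exact h0
      · exact hb'.1 i (by omega)
    refine ⟨p.coeff m / r.coeff m, key _ ((poleDegree_smul_basis_lt _ _ _).mpr
      ⟨fun i hi => ?_, fun i hi => ?_⟩)⟩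
    · rcases eq_or_ne i m with rfl | him
      · simp [div_mul_cancel₀ _ hr]
      · simp [ha'.1 i (by omega), hb'.1 i (by omega)]
    · simp [ha'.2 i (by omega), hb'.2 i (by omega)]
  · have hs : s.coeff (m - 1) ≠ 0 := by
      intro h0
      refine hb'' ⟨fun i hi => hb'.1 i (by omega), fun i hi => ?_⟩
      rcases eq_or_ne i (m - 1) with rfl | him
      · exact h0
      · exact hb'.2 i (by omega)
    refine ⟨q.coeff (m - 1) / s.coeff (m - 1), key _ ((poleDegree_smul_basis_lt _ _ _).mpr
      ⟨fun i hi => ?_, fun i hi => ?_⟩)⟩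
    · simp [ha'.1 i (by omega), hb'.1 i (by omega)]
    · rcases eq_or_ne i (m - 1) with rfl | him
      · simp [div_mul_cancel₀ _ hs]
      · simp [ha'.2 i (by omega), hb'.2 i (by omega)]

theorem exists_eq_algebraMap_of_poleDegree_lt_two {a : W.CoordinateRing} (ha : poleDegree a < 2) :
    ∃ c : k, a = algebraMap k W.CoordinateRing c := by
  obtain ⟨p, q, rfl⟩ := CoordinateRing.exists_smul_basis_eq a
  have h := (poleDegree_smul_basis_lt (W := W) p q 2).mp ha
  have hq : q = 0 := Polynomial.ext fun i => h.2 i (by omega)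
  have hp : p = Polynomial.C (p.coeff 0) := by
    ext i
    rcases i with _ | i
    · simp
    · rw [h.1 _ (by omega), Polynomial.coeff_C_succ]
  refine ⟨p.coeff 0, ?_⟩
  rw [hq, zero_smul, add_zero, hp, Polynomial.coeff_C_zero, Algebra.smul_def, mul_one]
  rfl

theorem poleDegree_xCoord_sub (l : k) :
    poleDegree (xCoord W - algebraMap k W.CoordinateRing l) = 2 := by
  have h : xCoord W - algebraMap k W.CoordinateRing l =
      (Polynomial.X - Polynomial.C l : k[X]) • (1 : W.CoordinateRing) + (0 : k[X]) • yCoord W := by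
    rw [zero_smul, add_zero, Algebra.smul_def, mul_one, map_sub]
    rfl
  rw [h, poleDegree_smul_basis, Polynomial.degree_X_sub_C, Polynomial.degree_zero, two_nsmul,
      two_nsmul, WithBot.bot_add, WithBot.bot_add, max_bot_right]
  rfl

theorem poleDegree_algebraMap {c : k} (hc : c ≠ 0) :
    poleDegree (algebraMap k W.CoordinateRing c) = 0 := by
  have h : algebraMap k W.CoordinateRing c =
      (Polynomial.C c : k[X]) • (1 : W.CoordinateRing) + (0 : k[X]) • yCoord W := by
    rw [zero_smul, add_zero, Algebra.smul_def, mul_one]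
    rfl
  rw [h, poleDegree_smul_basis, Polynomial.degree_C hc, Polynomial.degree_zero, two_nsmul,
      two_nsmul, WithBot.bot_add, WithBot.bot_add, max_bot_right, add_zero]

/-- Division with remainder by an element `a` of an ideal with minimal pole order `d`: the elements
of pole order `d + 1` are the only obstruction. -/
theorem exists_eq_mul_add_smul {I : Ideal W.CoordinateRing} {a b : W.CoordinateRing} {d : ℕ}
    (ha : a ∈ I) (hb : b ∈ I) (had : poleDegree a = d)
    (hmin : ∀ e ∈ I, e ≠ 0 → (d : WithBot ℕ) ≤ poleDegree e)
    (hbd : ∀ e ∈ I, poleDegree e = (d + 1 : ℕ) → ∃ c : k, poleDegree (e - c • b) < (d + 1 : ℕ)) :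
    ∀ (n : ℕ), ∀ e ∈ I, poleDegree e < n → ∃ r, ∃ c : k, e = r * a + c • b := by
  intro n
  induction n with
  | zero =>
    intro e _ hen
    have : e = 0 := poleDegree_eq_bot.mp (by
      by_contra h
      obtain ⟨m, hm⟩ := exists_poleDegree_eq_natCast (poleDegree_eq_bot.not.mp h)
      rw [hm, Nat.cast_lt] at hen
      omega)
    exact ⟨0, 0, by simp [this]⟩
  | succ n ih =>
    intro e he hen
    by_cases hlt : poleDegree e < n
    · exact ih e he hlt
    have hn : poleDegree e = n := by
      refine le_antisymm ?_ (not_lt.mp hlt)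
      rcases eq_or_ne e 0 with rfl | h0
      · rw [poleDegree_eq_bot.mpr rfl]; exact bot_le
      obtain ⟨m, hm⟩ := exists_poleDegree_eq_natCast h0
      rw [hm, Nat.cast_lt] at hen
      rw [hm, Nat.cast_le]
      omega
    by_cases hd : n = d + 1
    · subst hd
      obtain ⟨c, hc⟩ := hbd e he hn
      have hmem : e - c • b ∈ I := I.sub_mem he (by
        rw [Algebra.smul_def]; exact I.mul_mem_left _ hb)
      obtain ⟨r, c', h⟩ := ih _ hmem hc
      exact ⟨r, c' + c, by rw [add_smul, ← add_assoc, ← h, sub_add_cancel]⟩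
    · have hdn : d ≤ n := by
        have := hmin e he (fun h0 => by rw [h0, poleDegree_eq_bot.mpr rfl] at hn; cases hn)
        rw [hn] at this
        exact_mod_cast this
      -- A multiplier of pole order `n - d` exists because `n - d ≠ 1`; this is why only the order
      -- `d + 1` needs `b`.
      obtain ⟨r, hr⟩ := exists_poleDegree_eq (W := W) (n := n - d) (by omega)
      have hra : poleDegree (r * a) = n := by
        rw [poleDegree_mul, hr, had]
        exact_mod_cast (by omega : n - d + d = n)
      obtain ⟨c, hc⟩ := exists_poleDegree_sub_lt hn hra
      have hmem : e - c • (r * a) ∈ I := I.sub_mem he (by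
        rw [Algebra.smul_def]; exact I.mul_mem_left _ (I.mul_mem_left _ ha))
      obtain ⟨r', c', h⟩ := ih _ hmem hc
      exact ⟨r' + c • r, c', by
        rw [add_mul, smul_mul_assoc, add_right_comm, ← h, sub_add_cancel]⟩

/-- If an element `b` is an eigenvector of `x` and `y` modulo `a`, then the eigenvalues are the
coordinates of a point of the curve, or `a` divides `b`. -/
theorem dvd_of_eigenvector (hW : ∀ x y : k, ¬ W.Equation x y) {a b r s : W.CoordinateRing} {l m : k}
    (hx : xCoord W * b = r * a + l • b) (hy : yCoord W * b = s * a + m • b) : a ∣ b := by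
  have hne : m ^ 2 + W.a₁ * l * m + W.a₃ * m - (l ^ 3 + W.a₂ * l ^ 2 + W.a₄ * l + W.a₆) ≠ 0 :=
    fun h => hW l m ((equation_iff' l m).mpr h)
  set ι := algebraMap k W.CoordinateRing with hι
  have hu : IsUnit (ι (m ^ 2 + W.a₁ * l * m + W.a₃ * m -
    (l ^ 3 + W.a₂ * l ^ 2 + W.a₄ * l + W.a₆))) := (isUnit_iff_ne_zero.mpr hne).map ι
  rw [← hu.dvd_mul_left]
  have hE := weierstrass_equation_coord W
  simp only [Algebra.smul_def, ← hι] at hx hy hE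
  set x := xCoord W
  set y := yCoord W
  -- Let `E` be the Weierstrass polynomial. Expanding `E(x, y) - E(l, m)` in `x - l` and `y - m`,
  -- and replacing `(x - l) * b` by `r * a` and `(y - m) * b` by `s * a`, expresses `E(l, m) * b` as
  -- a multiple of `a`, since `E(x, y) = 0`.
  refine ⟨-(s * (y + ι m) + ι W.a₁ * (r * y + ι l * s) + ι W.a₃ * s
    - (r * (x ^ 2 + x * ι l + ι l ^ 2) + ι W.a₂ * (r * (x + ι l)) + ι W.a₄ * r)), ?_⟩
  simp only [map_add, map_sub, map_mul, map_pow]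
  linear_combination b * hE - (y + ι m) * hy - ι W.a₁ * (y * hx + ι l * hy) - ι W.a₃ * hy +
    (x ^ 2 + x * ι l + ι l ^ 2) * hx + ι W.a₂ * (x + ι l) * hx + ι W.a₄ * hx

/-- The coordinate ring of a Weierstrass curve without affine rational points is a principal ideal
ring. -/
theorem isPrincipalIdealRing_coordinateRing (hW : ∀ x y : k, ¬ W.Equation x y) :
    IsPrincipalIdealRing W.CoordinateRing := by
  refine ⟨fun I => ?_⟩
  by_cases hI : I = ⊥
  · rw [hI]; infer_instance
  have hex : ∃ d : ℕ, ∃ a ∈ I, poleDegree a = d := by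
    obtain ⟨a, ha, h0⟩ := Submodule.exists_mem_ne_zero_of_ne_bot hI
    obtain ⟨d, hd⟩ := exists_poleDegree_eq_natCast h0
    exact ⟨d, a, ha, hd⟩
  classical
  obtain ⟨a, ha, had⟩ := Nat.find_spec hex
  set d := Nat.find hex
  have hmin : ∀ e ∈ I, e ≠ 0 → (d : WithBot ℕ) ≤ poleDegree e := by
    intro e he h0
    obtain ⟨m, hm⟩ := exists_poleDegree_eq_natCast h0
    rw [hm, Nat.cast_le]
    exact Nat.find_min' hex ⟨e, he, hm⟩
  have hlt : ∀ e : W.CoordinateRing, ∃ n : ℕ, poleDegree e < n := by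
    intro e
    rcases eq_or_ne e 0 with rfl | h0
    · exact ⟨0, by rw [poleDegree_eq_bot.mpr rfl]; exact WithBot.bot_lt_coe _⟩
    obtain ⟨m, hm⟩ := exists_poleDegree_eq_natCast h0
    exact ⟨m + 1, by rw [hm, Nat.cast_lt]; omega⟩
  refine ⟨⟨a, le_antisymm ?_ ((Ideal.span_singleton_le_iff_mem I).mpr ha)⟩⟩
  by_cases hb : ∃ b ∈ I, poleDegree b = (d + 1 : ℕ)
  · obtain ⟨b, hb, hbd⟩ := hb
    have hrep : ∀ e ∈ I, ∃ r, ∃ c : k, e = r * a + c • b := by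
      intro e he
      obtain ⟨n, hn⟩ := hlt e
      exact exists_eq_mul_add_smul ha hb had hmin
        (fun e _ hed => exists_poleDegree_sub_lt hed hbd) n e he hn
    -- The quotient of `I` by `(a)` is spanned over `k` by the class of `b`, so `x` and `y` act on
    -- it by scalars. These would be the coordinates of a rational point unless `a` divides `b`.
    obtain ⟨r, l, hx⟩ := hrep _ (I.mul_mem_left (xCoord W) hb)
    obtain ⟨s, m, hy⟩ := hrep _ (I.mul_mem_left (yCoord W) hb)
    have hab := dvd_of_eigenvector hW hx hy
    intro e he
    obtain ⟨r, c, rfl⟩ := hrep e he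
    refine Ideal.mem_span_singleton.mpr (dvd_add (dvd_mul_left a r) ?_)
    rw [Algebra.smul_def]
    exact hab.mul_left _
  · intro e he
    obtain ⟨n, hn⟩ := hlt e
    -- No element of `I` has pole order `d + 1`, so division by `a` meets no obstruction and `b = 0`
    -- serves.
    obtain ⟨r, c, h⟩ := exists_eq_mul_add_smul ha I.zero_mem had hmin
      (fun e he hed => absurd ⟨e, he, hed⟩ hb) n e he hn
    rw [h, smul_zero, add_zero]
    exact Ideal.mem_span_singleton.mpr (dvd_mul_left a r)

theorem isUnit_of_poleDegree_eq_zero {a : W.CoordinateRing} (ha : poleDegree a = 0) : IsUnit a := by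
  obtain ⟨c, rfl⟩ := exists_eq_algebraMap_of_poleDegree_lt_two (a := a) (by rw [ha]; decide)
  have hc : c ≠ 0 := by
    rintro rfl
    rw [map_zero, poleDegree_eq_bot.mpr rfl] at ha
    cases ha
  exact (isUnit_iff_ne_zero.mpr hc).map _

/-- In a principal ideal ring irreducibility suffices. The pole orders of two factors add up to `2`
and neither is `1`, so one of them is `0` and that factor is a constant. -/
theorem prime_xCoord_sub (hW : ∀ x y : k, ¬ W.Equation x y) (l : k) :
    Prime (xCoord W - algebraMap k W.CoordinateRing l) := by
  have := isPrincipalIdealRing_coordinateRing hW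
  refine Irreducible.prime ⟨fun hu => ?_, fun a b hab => ?_⟩
  · obtain ⟨b, hb⟩ := hu.exists_right_inv
    have h := poleDegree_xCoord_sub (W := W) l
    have h1 : poleDegree (1 : W.CoordinateRing) = 0 := by
      rw [← map_one (algebraMap k W.CoordinateRing)]
      exact poleDegree_algebraMap one_ne_zero
    have hb0 : b ≠ 0 := by rintro rfl; simp at hb
    obtain ⟨n, hn⟩ := exists_poleDegree_eq_natCast hb0
    rw [← hb, poleDegree_mul, h, hn] at h1
    norm_cast at h1
    omega
  · have h := poleDegree_xCoord_sub (W := W) l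
    have hne : xCoord W - algebraMap k W.CoordinateRing l ≠ 0 := by
      intro h0
      rw [poleDegree_eq_bot.mpr h0] at h
      cases h
    rw [hab] at hne
    obtain ⟨m, hm⟩ := exists_poleDegree_eq_natCast (left_ne_zero_of_mul hne)
    obtain ⟨n, hn⟩ := exists_poleDegree_eq_natCast (right_ne_zero_of_mul hne)
    have hm1 := poleDegree_ne_one a
    rw [hab, poleDegree_mul, hm, hn] at h
    rw [hm] at hm1
    norm_cast at h hm1
    rcases (by omega : m = 0 ∨ n = 0) with rfl | rfl
    · exact Or.inl (isUnit_of_poleDegree_eq_zero hm)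
    · exact Or.inr (isUnit_of_poleDegree_eq_zero hn)

end CoordinateRing

/-! ### Places of the function field -/

section CurvePlaces

open WeierstrassCurve.Affine

variable {k : Type*} [Field k] {W : WeierstrassCurve.Affine k}

theorem Place.valuation_algebraMap {F : Type*} [Field F] [Algebra k F] (w : Place k F) {c : k}
    (hc : c ≠ 0) : w.ring.valuation (algebraMap k F c) = 1 := by
  refine le_antisymm ((w.ring.valuation_le_one_iff _).mpr (w.algebraMap_mem c)) ?_
  have h := (w.ring.valuation_le_one_iff _).mpr (w.algebraMap_mem c⁻¹)
  rw [map_inv₀, map_inv₀] at h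
  have h0 : 0 < w.ring.valuation (algebraMap k F c) := zero_lt_iff.mpr (by simpa using hc)
  exact (inv_le_one₀ h0).mp h

instance {F : Type*} [Field F] [Algebra k F] (w : Place k F) : w.ring.valuation.IsTrivialOn k :=
  ⟨fun _ hc => w.valuation_algebraMap hc⟩

theorem algebraMap_smul_basis (p q : k[X]) :
    algebraMap W.CoordinateRing W.FunctionField (p • (1 : W.CoordinateRing) + q • yCoord W) =
      Polynomial.aeval (xFun W) p + Polynomial.aeval (xFun W) q * yFun W := by
  have h : ∀ r : k[X], Polynomial.aeval (xFun W) r =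
      algebraMap W.CoordinateRing W.FunctionField (algebraMap k[X] W.CoordinateRing r) := by
    intro r
    have hx : xFun W = algebraMap W.CoordinateRing W.FunctionField
      (algebraMap k[X] W.CoordinateRing Polynomial.X) := rfl
    rw [hx, Polynomial.aeval_algebraMap_apply, Polynomial.aeval_algebraMap_apply,
      Polynomial.aeval_X_left_apply]
  rw [h, h, map_add, Algebra.smul_def, Algebra.smul_def, mul_one, map_mul]
  rfl

theorem weierstrass_equation_fun :
    yFun W * (yFun W + (algebraMap k _ W.a₁ * xFun W + algebraMap k _ W.a₃)) =
      xFun W ^ 3 + (algebraMap k _ W.a₂ * xFun W ^ 2 + algebraMap k _ W.a₄ * xFun W +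
        algebraMap k _ W.a₆) := by
  have h := congrArg (algebraMap W.CoordinateRing W.FunctionField) (weierstrass_equation_coord W)
  simp only [Algebra.smul_def, map_add, map_mul, map_pow, ← IsScalarTower.algebraMap_apply] at h
  change (yFun W) ^ 2 + _ * (xFun W * yFun W) + _ * yFun W =
    xFun W ^ 3 + _ * xFun W ^ 2 + _ * xFun W + _ at h
  linear_combination h

/-! ### Valuations at a pole of `x`, and integrality of the coordinate ring elsewhere. -/

variable (w : Place k W.FunctionField)

theorem Place.valuation_algebraMap_le_one {F : Type*} [Field F] [Algebra k F] (w : Place k F)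
    (c : k) : w.ring.valuation (algebraMap k F c) ≤ 1 :=
  (w.ring.valuation_le_one_iff _).mpr (w.algebraMap_mem c)

/-- The value of `y / x` at a place. -/
def poleValue : w.ring.ValueGroup := w.ring.valuation (yFun W / xFun W)

variable {w}

/-- At a pole of `x` the term `x ^ 3` dominates the right side of the Weierstrass equation. Were `y`
no larger than `x`, the left side would have at most the size of `x ^ 2`; hence `y` is larger and `y
^ 2` dominates the left side. -/
theorem valuation_xFun_lt_yFun (hx : xFun W ∉ w.ring) :
    w.ring.valuation (xFun W) < w.ring.valuation (yFun W) ∧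
      w.ring.valuation (yFun W) ^ 2 = w.ring.valuation (xFun W) ^ 3 := by
  set v := w.ring.valuation with hv
  have hx1 : 1 < v (xFun W) := by
    rw [← not_le, hv, w.ring.valuation_le_one_iff]; exact hx
  have hlin : ∀ c d : k, v (algebraMap k _ c * xFun W + algebraMap k _ d) ≤ v (xFun W) := by
    intro c d
    refine (v.map_add _ _).trans (max_le ?_ ((w.valuation_algebraMap_le_one d).trans hx1.le))
    rw [map_mul]
    exact mul_le_of_le_one_left' (w.valuation_algebraMap_le_one c)
  have hrhs : v (xFun W ^ 3 + (algebraMap k _ W.a₂ * xFun W ^ 2 + algebraMap k _ W.a₄ * xFun W +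
        algebraMap k _ W.a₆)) = v (xFun W) ^ 3 := by
    rw [← map_pow]
    refine v.map_add_eq_of_lt_left ?_
    rw [map_pow, add_assoc]
    have h2 : v (xFun W) ^ 2 < v (xFun W) ^ 3 := pow_lt_pow_right₀ hx1 (by norm_num)
    refine lt_of_le_of_lt ((v.map_add _ _).trans (max_le ?_ ((hlin _ _).trans ?_))) h2
    · rw [map_mul, map_pow]
      exact mul_le_of_le_one_left' (w.valuation_algebraMap_le_one _)
    · exact le_self_pow₀ hx1.le (by norm_num)
  rw [← weierstrass_equation_fun, map_mul] at hrhs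
  have hlt : v (xFun W) < v (yFun W) := by
    by_contra hle
    rw [not_lt] at hle
    have h1 : v (yFun W + (algebraMap k _ W.a₁ * xFun W + algebraMap k _ W.a₃)) ≤ v (xFun W) :=
      (v.map_add _ _).trans (max_le hle (hlin _ _))
    have h2 := mul_le_mul' hle h1
    rw [hrhs, ← sq] at h2
    exact absurd h2 (not_le.mpr (pow_lt_pow_right₀ hx1 (by norm_num)))
  refine ⟨hlt, ?_⟩
  rw [v.map_add_eq_of_lt_left (lt_of_le_of_lt (hlin _ _) hlt), ← sq] at hrhs
  exact hrhs

theorem one_lt_poleValue (hx : xFun W ∉ w.ring) : 1 < poleValue w := by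
  have h := (valuation_xFun_lt_yFun hx).1
  rw [poleValue, map_div₀, one_lt_div₀ (zero_lt_iff.mpr (by simpa using xFun_ne_zero W))]
  exact h

theorem poleValue_sq (hx : xFun W ∉ w.ring) : w.ring.valuation (xFun W) = poleValue w ^ 2 := by
  have h0 : w.ring.valuation (xFun W) ≠ 0 := by simpa using xFun_ne_zero W
  rw [poleValue, map_div₀, div_pow, (valuation_xFun_lt_yFun hx).2, pow_succ,
    mul_div_cancel_left₀ _ (pow_ne_zero 2 h0)]

theorem poleValue_cube (hx : xFun W ∉ w.ring) : w.ring.valuation (yFun W) = poleValue w ^ 3 := by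
  have h0 : w.ring.valuation (xFun W) ≠ 0 := by simpa using xFun_ne_zero W
  rw [pow_succ, ← poleValue_sq hx, poleValue, map_div₀, mul_div_cancel₀ _ h0]

theorem valuation_aeval_xFun (hx : xFun W ∉ w.ring) {p : k[X]} (hp : p ≠ 0) :
    w.ring.valuation (Polynomial.aeval (xFun W) p) = poleValue w ^ (2 * p.natDegree) := by
  rw [Polynomial.valuation_aeval_eq_valuation_X_pow_natDegree_of_one_lt_valuation_X _ _ hp,
    poleValue_sq hx, pow_mul]
  rw [← not_le, w.ring.valuation_le_one_iff]
  exact hx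

/-- At a pole of `x`, the valuation of an element of the coordinate ring is given by its pole
order. -/
theorem valuation_eq_poleValue_pow (hx : xFun W ∉ w.ring) {a : W.CoordinateRing} {n : ℕ}
    (ha : poleDegree a = n) :
    w.ring.valuation (algebraMap W.CoordinateRing W.FunctionField a) = poleValue w ^ n := by
  obtain ⟨p, q, rfl⟩ := CoordinateRing.exists_smul_basis_eq a
  change poleDegree (p • (1 : W.CoordinateRing) + q • yCoord W) = n at ha
  change w.ring.valuation (algebraMap W.CoordinateRing W.FunctionField
    (p • (1 : W.CoordinateRing) + q • yCoord W)) = poleValue w ^ n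
  rw [poleDegree_smul_basis] at ha
  rw [algebraMap_smul_basis]
  have hT := one_lt_poleValue hx
  rcases eq_or_ne p 0 with rfl | hp <;> rcases eq_or_ne q 0 with rfl | hq
  · simp at ha
  · rw [Polynomial.degree_zero, two_nsmul, two_nsmul, WithBot.bot_add, max_bot_left,
      Polynomial.degree_eq_natDegree hq] at ha
    norm_cast at ha
    rw [map_zero, zero_add, map_mul, valuation_aeval_xFun hx hq, poleValue_cube hx, ← pow_add,
      ← ha, two_mul]
  · rw [Polynomial.degree_zero, two_nsmul, two_nsmul, WithBot.bot_add, WithBot.bot_add,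
      max_bot_right, Polynomial.degree_eq_natDegree hp] at ha
    norm_cast at ha
    rw [map_zero, zero_mul, add_zero, valuation_aeval_xFun hx hp, ← ha, two_mul]
  · rw [Polynomial.degree_eq_natDegree hp, Polynomial.degree_eq_natDegree hq, two_nsmul,
      two_nsmul] at ha
    norm_cast at ha
    have h1 := valuation_aeval_xFun hx hp
    have h2 : w.ring.valuation (Polynomial.aeval (xFun W) q * yFun W) =
        poleValue w ^ (2 * q.natDegree + 3) := by
      rw [map_mul, valuation_aeval_xFun hx hq, poleValue_cube hx, ← pow_add]
    -- The two orders have different parity, so the leading terms cannot cancel.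
    rcases lt_or_gt_of_ne (by omega : 2 * p.natDegree ≠ 2 * q.natDegree + 3) with h | h
    · rw [Valuation.map_add_eq_of_lt_right, h2]
      · rw [max_eq_right (Nat.cast_le.mpr (by omega)), Nat.cast_inj] at ha
        congr 1; omega
      · rw [h1, h2]; exact pow_lt_pow_right₀ hT h
    · rw [Valuation.map_add_eq_of_lt_left, h1]
      · rw [max_eq_left (Nat.cast_le.mpr (by omega)), Nat.cast_inj] at ha
        congr 1; omega
      · rw [h1, h2]; exact pow_lt_pow_right₀ hT h

/-- The function `x` has a single pole. -/
theorem place_eq_of_xFun_notMem {w' : Place k W.FunctionField} (hx : xFun W ∉ w.ring)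
    (hx' : xFun W ∉ w'.ring) : w = w' := by
  ext z
  obtain ⟨a, b, hb, rfl⟩ := IsFractionRing.div_surjective (A := W.CoordinateRing) z
  rcases eq_or_ne a 0 with rfl | ha
  · simp [zero_mem]
  obtain ⟨m, hm⟩ := exists_poleDegree_eq_natCast ha
  obtain ⟨n, hn⟩ := exists_poleDegree_eq_natCast (nonZeroDivisors.ne_zero hb)
  -- At either place the quotient is integral exactly when `m ≤ n`, a condition that does not see
  -- the place.
  rw [← w.ring.valuation_le_one_iff, ← w'.ring.valuation_le_one_iff, map_div₀, map_div₀,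
    valuation_eq_poleValue_pow hx hm, valuation_eq_poleValue_pow hx hn,
    valuation_eq_poleValue_pow hx' hm, valuation_eq_poleValue_pow hx' hn,
    div_le_one₀ (pow_pos (zero_lt_one.trans (one_lt_poleValue hx)) _),
    div_le_one₀ (pow_pos (zero_lt_one.trans (one_lt_poleValue hx')) _),
    pow_le_pow_iff_right₀ (one_lt_poleValue hx), pow_le_pow_iff_right₀ (one_lt_poleValue hx')]

theorem xFun_mem_iff : xFun W ∈ w.ring ↔ w ≠ placeAtInfinity W := by
  constructor
  · rintro h rfl
    exact xFun_notMem_placeAtInfinity W h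
  · intro h
    by_contra hx
    exact h (place_eq_of_xFun_notMem hx (xFun_notMem_placeAtInfinity W))

/-- Since `x` is integral at `w`, so is `y`: otherwise `y ^ 2` would dominate the left side of the
Weierstrass equation, whose right side is integral. -/
theorem algebraMap_coordinateRing_mem (hw : w ≠ placeAtInfinity W) (a : W.CoordinateRing) :
    algebraMap W.CoordinateRing W.FunctionField a ∈ w.ring := by
  have hx := xFun_mem_iff.mpr hw
  have hpoly : ∀ p : k[X], Polynomial.aeval (xFun W) p ∈ w.ring := by
    intro p
    rw [Polynomial.aeval_eq_sum_range]
    refine sum_mem fun i _ => ?_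
    rw [Algebra.smul_def]
    exact mul_mem (w.algebraMap_mem _) (pow_mem hx i)
  have hy : yFun W ∈ w.ring := by
    by_contra hy
    have hlin : algebraMap k _ W.a₁ * xFun W + algebraMap k _ W.a₃ ∈ w.ring :=
      add_mem (mul_mem (w.algebraMap_mem _) hx) (w.algebraMap_mem _)
    have hrhs : yFun W * (yFun W + (algebraMap k _ W.a₁ * xFun W + algebraMap k _ W.a₃)) ∈
        w.ring := by
      rw [weierstrass_equation_fun]
      exact add_mem (pow_mem hx 3) (add_mem (add_mem (mul_mem (w.algebraMap_mem _) (pow_mem hx 2))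
        (mul_mem (w.algebraMap_mem _) hx)) (w.algebraMap_mem _))
    rw [← w.ring.valuation_le_one_iff] at hy hlin hrhs
    rw [not_le] at hy
    rw [map_mul, Valuation.map_add_eq_of_lt_left _ (hlin.trans_lt hy)] at hrhs
    exact absurd hrhs (not_le.mpr (one_lt_mul'' hy hy))
  obtain ⟨p, q, rfl⟩ := CoordinateRing.exists_smul_basis_eq a
  change algebraMap W.CoordinateRing W.FunctionField (p • (1 : W.CoordinateRing) + q • yCoord W) ∈ _
  rw [algebraMap_smul_basis]
  exact add_mem (hpoly p) (mul_mem (hpoly q) hy)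

theorem valuation_algebraMap_le_one (hw : w ≠ placeAtInfinity W) (a : W.CoordinateRing) :
    w.ring.valuation (algebraMap W.CoordinateRing W.FunctionField a) ≤ 1 :=
  (w.ring.valuation_le_one_iff _).mpr (algebraMap_coordinateRing_mem hw a)

/-! ### Finite places and primes of the coordinate ring. -/

variable [IsPrincipalIdealRing W.CoordinateRing]

/-- The intersection of the valuation rings of the finite places is the coordinate ring. -/
theorem exists_algebraMap_eq_of_forall_mem {r : W.FunctionField}
    (hr : ∀ w : Place k W.FunctionField, w ≠ placeAtInfinity W → r ∈ w.ring) :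
    ∃ a, algebraMap W.CoordinateRing W.FunctionField a = r := by
  have key : r ∈ (⨅ V : {V : ValuationSubring W.FunctionField //
      ((algebraMap W.CoordinateRing W.FunctionField).range : Set W.FunctionField) ⊆ V.toSubring},
      V.1.toSubring) := by
    rw [Subring.mem_iInf]
    rintro ⟨V, hV⟩
    by_cases hT : V = ⊤
    · subst hT; exact ValuationSubring.mem_top _
    · let w : Place k W.FunctionField := ⟨V, fun a => hV ⟨algebraMap k _ a,
        (IsScalarTower.algebraMap_apply k W.CoordinateRing W.FunctionField a).symm⟩, hT⟩
      exact hr w (xFun_mem_iff.mp (hV ⟨_, rfl⟩))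
  -- The intersection of the valuation rings containing a subring is its integral closure, and a
  -- principal ideal domain is integrally closed.
  rw [iInf_valuationSubring_superset] at key
  have h : IsIntegral (Subring.closure ((algebraMap W.CoordinateRing W.FunctionField).range :
      Set W.FunctionField)) r := key
  rw [Subring.closure_eq] at h
  have h' : IsIntegral W.CoordinateRing r := by
    obtain ⟨p, hp, hev⟩ := h
    obtain ⟨q, hq, -, hqm⟩ := Polynomial.lifts_and_degree_eq_and_monic
      (Polynomial.map_surjective _
        (algebraMap W.CoordinateRing W.FunctionField).rangeRestrict_surjective p) hp
    refine ⟨q, hqm, ?_⟩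
    rw [← hq, Polynomial.eval₂_map] at hev
    exact hev
  exact IsIntegrallyClosed.isIntegral_iff.mp h'

/-- Every prime of the coordinate ring is the center of a finite place. -/
theorem exists_place_of_prime {p : W.CoordinateRing} (hp : Prime p) :
    ∃ w : Place k W.FunctionField, w ≠ placeAtInfinity W ∧
      w.ring.valuation (algebraMap W.CoordinateRing W.FunctionField p) < 1 := by
  by_contra! hcon
  -- If `p` were a unit at all finite places, its inverse would be integral there and so lie in the
  -- coordinate ring.
  obtain ⟨b, hb⟩ := exists_algebraMap_eq_of_forall_mem
    (r := (algebraMap W.CoordinateRing W.FunctionField p)⁻¹) (fun w hw => by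
      rw [← w.ring.valuation_le_one_iff, map_inv₀]
      exact inv_le_one_of_one_le₀ (hcon w hw))
  refine hp.not_isUnit (IsUnit.of_mul_eq_one b ?_)
  apply IsFractionRing.injective W.CoordinateRing W.FunctionField
  rw [map_mul, hb, map_one, mul_inv_cancel₀]
  simpa using hp.ne_zero

/-- The center of a finite place in the coordinate ring is generated by a prime element. -/
theorem exists_prime_dvd_iff (hw : w ≠ placeAtInfinity W) :
    ∃ p : W.CoordinateRing, Prime p ∧ ∀ a,
      w.ring.valuation (algebraMap W.CoordinateRing W.FunctionField a) < 1 ↔ p ∣ a := by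
  let φ : W.CoordinateRing →+* w.ring :=
    (algebraMap W.CoordinateRing W.FunctionField).codRestrict w.ring.toSubring
      (algebraMap_coordinateRing_mem hw)
  let I : Ideal W.CoordinateRing := (IsLocalRing.maximalIdeal w.ring).comap φ
  have hI : ∀ a, a ∈ I ↔ w.ring.valuation (algebraMap W.CoordinateRing W.FunctionField a) < 1 :=
    fun a => w.ring.valuation_lt_one_iff (φ a)
  have hprime : I.IsPrime := Ideal.IsPrime.comap φ
  have hdvd : ∀ a, a ∈ I ↔ Submodule.IsPrincipal.generator I ∣ a :=
    fun a => Submodule.IsPrincipal.mem_iff_generator_dvd I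
  refine ⟨Submodule.IsPrincipal.generator I,
    Submodule.IsPrincipal.prime_generator_of_isPrime I ?_, fun a => (hI a).symm.trans (hdvd a)⟩
  -- With center zero, all non-zero elements of the coordinate ring would be units at `w`, and the
  -- valuation ring would be the whole field.
  intro hbot
  apply w.ne_top
  rw [eq_top_iff]
  intro z _
  obtain ⟨a, b, hb, rfl⟩ := IsFractionRing.div_surjective (A := W.CoordinateRing) z
  rw [← w.ring.valuation_le_one_iff, map_div₀]
  have hb1 : w.ring.valuation (algebraMap W.CoordinateRing W.FunctionField b) = 1 := by
    refine le_antisymm (valuation_algebraMap_le_one hw b) (not_lt.mp fun h => ?_)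
    rw [← hI, hbot, Ideal.mem_bot] at h
    exact nonZeroDivisors.ne_zero hb h
  rw [hb1, div_one]
  exact valuation_algebraMap_le_one hw a

/-- The valuation ring is the localization of the coordinate ring at `p`: a reduced fraction with
`p` in the denominator has a numerator of value one, hence is not integral. So a finite place is
determined by its prime. -/
theorem mem_ring_iff_exists (hw : w ≠ placeAtInfinity W) {p : W.CoordinateRing}
    (hp : ∀ a, w.ring.valuation (algebraMap W.CoordinateRing W.FunctionField a) < 1 ↔ p ∣ a)
    (hprime : Prime p) (z : W.FunctionField) :
    z ∈ w.ring ↔ ∃ a b : W.CoordinateRing, ¬ p ∣ b ∧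
      z = algebraMap _ W.FunctionField a / algebraMap _ W.FunctionField b := by
  constructor
  · intro hz
    obtain ⟨a, ⟨b, hb⟩, hab, rfl⟩ := IsFractionRing.exists_reduced_fraction
      (A := W.CoordinateRing) z
    rw [IsFractionRing.mk'_eq_div] at hz ⊢
    refine ⟨a, b, fun hpb => ?_, rfl⟩
    have hpa : ¬ p ∣ a := fun hpa => hprime.not_isUnit (hab hpa hpb)
    rw [← hp, not_lt] at hpa
    rw [← hp] at hpb
    have hb0 : 0 < w.ring.valuation (algebraMap W.CoordinateRing W.FunctionField b) :=
      zero_lt_iff.mpr (by simpa using nonZeroDivisors.ne_zero hb)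
    rw [← w.ring.valuation_le_one_iff, map_div₀, div_le_one₀ hb0] at hz
    exact absurd (hpa.trans hz) (not_le.mpr hpb)
  · rintro ⟨a, b, hb, rfl⟩
    rw [← hp, not_lt] at hb
    rw [← w.ring.valuation_le_one_iff, map_div₀]
    exact div_le_one_of_le₀ ((valuation_algebraMap_le_one hw a).trans hb) zero_le

/-- The valuation at a finite place of a non-zero function is a power of that of a uniformizer. -/
theorem exists_valuation_eq_zpow (hw : w ≠ placeAtInfinity W) {p : W.CoordinateRing}
    (hp : ∀ a, w.ring.valuation (algebraMap W.CoordinateRing W.FunctionField a) < 1 ↔ p ∣ a)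
    (hprime : Prime p) {z : W.FunctionField} (hz : z ≠ 0) :
    ∃ n : ℤ, w.ring.valuation z =
      w.ring.valuation (algebraMap W.CoordinateRing W.FunctionField p) ^ n := by
  have key : ∀ a : W.CoordinateRing, a ≠ 0 → ∃ n : ℕ,
      w.ring.valuation (algebraMap W.CoordinateRing W.FunctionField a) =
        w.ring.valuation (algebraMap W.CoordinateRing W.FunctionField p) ^ n := by
    intro a ha
    obtain ⟨n, b, hb, rfl⟩ := WfDvdMonoid.max_power_factor ha hprime.irreducible
    refine ⟨n, ?_⟩
    rw [← hp, not_lt] at hb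
    rw [map_mul, map_mul, map_pow, map_pow,
      le_antisymm (valuation_algebraMap_le_one hw b) hb, mul_one]
  obtain ⟨a, b, hb, rfl⟩ := IsFractionRing.div_surjective (A := W.CoordinateRing) z
  have ha : a ≠ 0 := by rintro rfl; simp at hz
  obtain ⟨m, hm⟩ := key a ha
  obtain ⟨n, hn⟩ := key b (nonZeroDivisors.ne_zero hb)
  refine ⟨m - n, ?_⟩
  rw [map_div₀, hm, hn, zpow_sub₀ (by simpa using hprime.ne_zero), zpow_natCast, zpow_natCast]

theorem valuation_eq_one_of_ne {w' : Place k W.FunctionField} (hw : w ≠ placeAtInfinity W)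
    (hw' : w' ≠ placeAtInfinity W) (hne : w' ≠ w) {p : W.CoordinateRing} (hprime : Prime p)
    (hp : w.ring.valuation (algebraMap W.CoordinateRing W.FunctionField p) < 1) :
    w'.ring.valuation (algebraMap W.CoordinateRing W.FunctionField p) = 1 := by
  refine le_antisymm (valuation_algebraMap_le_one hw' p) (not_lt.mp fun h => hne ?_)
  obtain ⟨q, hq, hqd⟩ := exists_prime_dvd_iff hw
  obtain ⟨q', hq', hqd'⟩ := exists_prime_dvd_iff hw'
  have h1 : Associated q p := hq.associated_of_dvd hprime ((hqd p).mp hp)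
  have h2 : Associated q' p := hq'.associated_of_dvd hprime ((hqd' p).mp h)
  have hd : ∀ a, w'.ring.valuation (algebraMap W.CoordinateRing W.FunctionField a) < 1 ↔ q ∣ a :=
    fun a => (hqd' a).trans (h2.trans h1.symm).dvd_iff_dvd_left
  ext z
  rw [mem_ring_iff_exists hw' hd hq, mem_ring_iff_exists hw hqd hq]

theorem valuation_lt_one_iff_dvd (hw : w ≠ placeAtInfinity W) {p : W.CoordinateRing}
    (hprime : Prime p)
    (hp : w.ring.valuation (algebraMap W.CoordinateRing W.FunctionField p) < 1)
    (a : W.CoordinateRing) :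
    w.ring.valuation (algebraMap W.CoordinateRing W.FunctionField a) < 1 ↔ p ∣ a := by
  obtain ⟨q, hq, hqd⟩ := exists_prime_dvd_iff hw
  exact (hqd a).trans (hq.associated_of_dvd hprime ((hqd p).mp hp)).dvd_iff_dvd_left

end CurvePlaces

/-! ### Completions and integral matrices -/

section LocalTheory

variable {k F : Type*} [Field k] [Field F] [Algebra k F]

theorem mem_range_map_subtype_iff {R : Type*} [CommRing R] (S : Subring R) (g : GL (Fin 2) R) :
    g ∈ (Matrix.GeneralLinearGroup.map (n := Fin 2) S.subtype).range ↔
      (∀ i j, g i j ∈ S) ∧ ∀ i j, g⁻¹ i j ∈ S := by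
  constructor
  · rintro ⟨h, rfl⟩
    refine ⟨fun i j => (h i j).2, fun i j => ?_⟩
    rw [← map_inv]
    exact (h⁻¹ i j).2
  · rintro ⟨h1, h2⟩
    have hinj : Function.Injective (S.subtype.mapMatrix (m := Fin 2)) :=
      fun a b hab => by
        ext i j
        exact congrFun (congrFun hab i) j
    let a : Matrix (Fin 2) (Fin 2) S := Matrix.of fun i j => ⟨g i j, h1 i j⟩
    let b : Matrix (Fin 2) (Fin 2) S := Matrix.of fun i j => ⟨g⁻¹ i j, h2 i j⟩
    have ha : S.subtype.mapMatrix a = (g : Matrix (Fin 2) (Fin 2) R) := rfl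
    have hb : S.subtype.mapMatrix b = ((g⁻¹ : GL (Fin 2) R) : Matrix (Fin 2) (Fin 2) R) := rfl
    refine ⟨⟨a, b, hinj ?_, hinj ?_⟩, ?_⟩
    · rw [map_mul, map_one, ha, hb, ← Units.val_mul, mul_inv_cancel, Units.val_one]
    · rw [map_mul, map_one, ha, hb, ← Units.val_mul, inv_mul_cancel, Units.val_one]
    · ext i j
      rfl

theorem Place.valued_embed (w : Place k F) (x : F) :
    Valued.v (w.embed x) = w.ring.valuation x :=
  Valued.valuedCompletion_apply _

theorem Place.exists_valued_eq (w : Place k F) (z : w.Completion) :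
    ∃ x : F, Valued.v z = w.ring.valuation x := by
  obtain ⟨r, hr⟩ := Valued.exists_coe_eq_v z
  exact ⟨r.ofVal, hr⟩

theorem Place.exists_valued_sub_lt_one (w : Place k F) (z : w.Completion) :
    ∃ x : F, Valued.v (z - w.embed x) < 1 := by
  have hopen : {u : w.Completion | Valued.v (u - z) < 1} ∈ nhds z := by
    rw [Valued.mem_nhds]
    refine ⟨1, fun u hu => ?_⟩
    simpa using hu
  obtain ⟨_, ⟨r, rfl⟩, hu⟩ := (UniformSpace.Completion.denseRange_coe
    (α := WithVal w.ring.valuation)).inter_nhds_nonempty hopen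
  exact ⟨r.ofVal, by rw [Valuation.map_sub_swap]; exact hu⟩

/-- The compact group `GL₂(𝒪_w)`. -/
def Place.localCompact (w : Place k F) : Subgroup (GL (Fin 2) w.Completion) :=
  (Matrix.GeneralLinearGroup.map (n := Fin 2) w.integers.subtype).range

/-- The inverse is the adjugate divided by the determinant, so once the entries are integral a unit
determinant replaces the conditions on `g⁻¹`. -/
theorem mem_localCompact_iff {w : Place k F} {g : GL (Fin 2) w.Completion} :
    g ∈ w.localCompact ↔ (∀ i j, Valued.v (g i j) ≤ 1) ∧ Valued.v (g.1.det) = 1 := by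
  rw [Place.localCompact, mem_range_map_subtype_iff]
  have hmem : ∀ x : w.Completion, x ∈ w.integers ↔ Valued.v x ≤ 1 := fun x => Iff.rfl
  have hdet : ∀ h : GL (Fin 2) w.Completion, (∀ i j, h i j ∈ w.integers) →
      Valued.v h.1.det ≤ 1 := by
    intro h hh
    rw [← hmem, Matrix.det_fin_two]
    exact sub_mem (mul_mem (hh _ _) (hh _ _)) (mul_mem (hh _ _) (hh _ _))
  constructor
  · rintro ⟨h1, h2⟩
    refine ⟨h1, le_antisymm (hdet g h1) ?_⟩
    have h3 := hdet g⁻¹ h2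
    have h4 : Valued.v g.1.det * Valued.v (g⁻¹).1.det = 1 := by
      rw [← map_mul, ← Matrix.det_mul, ← Units.val_mul, mul_inv_cancel, Units.val_one,
        Matrix.det_one, map_one]
    calc (1 : w.ring.ValueGroup) = _ := h4.symm
      _ ≤ Valued.v g.1.det * 1 := mul_le_mul_right h3 _
      _ = _ := mul_one _
  · rintro ⟨h1, h2⟩
    refine ⟨h1, ?_⟩
    have hinv : ∀ i j, g⁻¹ i j = (g.1.det)⁻¹ * g.1.adjugate i j := by
      intro i j
      rw [Matrix.coe_units_inv, Matrix.inv_def, Ring.inverse_eq_inv, Matrix.smul_apply, smul_eq_mul]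
    intro i j
    rw [hmem, hinv, map_mul, map_inv₀, h2, inv_one, one_mul, Matrix.adjugate_fin_two]
    fin_cases i <;> fin_cases j <;> simp [h1]

/-- The group `GL₂(𝒪_w ∩ F)`. -/
def Place.ringGL2 (w : Place k F) : Subgroup (GL (Fin 2) F) :=
  w.localCompact.comap (Matrix.GeneralLinearGroup.map w.embed)

theorem mem_ringGL2_iff {w : Place k F} {g : GL (Fin 2) F} :
    g ∈ w.ringGL2 ↔ (∀ i j, g i j ∈ w.ring) ∧ w.ring.valuation g.1.det = 1 := by
  rw [Place.ringGL2, Subgroup.mem_comap, mem_localCompact_iff]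
  refine and_congr (forall₂_congr fun i j => ?_) ?_
  · rw [Matrix.GeneralLinearGroup.map_apply, w.valued_embed, w.ring.valuation_le_one_iff]
  · have : (Matrix.GeneralLinearGroup.map w.embed g).1.det = w.embed g.1.det :=
      (RingHom.map_det w.embed g.1).symm
    rw [this, w.valued_embed]

theorem affineMatrix_mem_ringGL2 {w : Place k F} {a : Fˣ} {b : F}
    (ha : w.ring.valuation (a : F) = 1) (hb : b ∈ w.ring) : affineMatrix a b ∈ w.ringGL2 := by
  rw [mem_ringGL2_iff]
  constructor
  · intro i j
    fin_cases i <;> fin_cases j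
    · exact (w.ring.valuation_le_one_iff _).mp ha.le
    · exact hb
    · exact zero_mem _
    · exact one_mem _
  · rw [Matrix.det_fin_two]
    simp [affineMatrix, ha]

theorem mem_maxCompact_iff {g : AdelicGL2 k F} :
    g ∈ maxCompact k F ↔
      ∀ w : Place k F, Matrix.GeneralLinearGroup.map (component w) g ∈ w.localCompact := by
  have hmem : ∀ x : Adele k F, x ∈ integralAdeles k F ↔
      ∀ w : Place k F, component w x ∈ w.integers := by
    intro x
    rw [integralAdeles, Subring.mem_iInf]
    rfl
  rw [maxCompact, mem_range_map_subtype_iff]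
  simp only [Place.localCompact, mem_range_map_subtype_iff, ← map_inv,
    Matrix.GeneralLinearGroup.map_apply, hmem]
  constructor
  · rintro ⟨h1, h2⟩ w
    exact ⟨fun i j => h1 i j w, fun i j => h2 i j w⟩
  · intro h
    exact ⟨fun i j w => (h w).1 i j, fun i j w => (h w).2 i j⟩

/-! ### Affine matrices and their components; invariance of forms. -/

theorem affineMatrix_mul {R : Type*} [CommRing R] (a a' : Rˣ) (b b' : R) :
    affineMatrix a b * affineMatrix a' b' = affineMatrix (a * a') (a * b' + b) := by
  ext i j; fin_cases i <;> fin_cases j <;> simp [affineMatrix]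

theorem map_affineMatrix {R S : Type*} [CommRing R] [CommRing S] (φ : R →+* S) (a : Rˣ) (b : R) :
    Matrix.GeneralLinearGroup.map φ (affineMatrix a b) =
      affineMatrix (Units.map (φ : R →* S) a) (φ b) := by
  ext i j; fin_cases i <;> fin_cases j <;> simp [affineMatrix]

theorem affineMatrix_one_zero {R : Type*} [CommRing R] : affineMatrix (1 : Rˣ) (0 : R) = 1 := by
  ext i j; fin_cases i <;> fin_cases j <;> simp [affineMatrix]

theorem map_component_localAffineMatrix_same (v : Place k F) (a : Fˣ) (b : F) :
    Matrix.GeneralLinearGroup.map (component v) (localAffineMatrix v a b) =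
      Matrix.GeneralLinearGroup.map v.embed (affineMatrix a b) := by
  classical
  rw [localAffineMatrix, map_affineMatrix, map_affineMatrix]
  congr 1
  · ext
    simp only [Units.coe_map, localIdele]
    exact RestrictedProduct.mulSingle_eq_same (A := fun v : Place k F => v.integers) v _
  · exact RestrictedProduct.single_eq_same (A := fun v : Place k F => v.integers) v _

theorem map_component_localAffineMatrix_of_ne {v w : Place k F} (h : w ≠ v) (a : Fˣ) (b : F) :
    Matrix.GeneralLinearGroup.map (component w) (localAffineMatrix v a b) = 1 := by
  classical
  rw [localAffineMatrix, map_affineMatrix, ← affineMatrix_one_zero]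
  congr 1
  · ext
    simp only [Units.coe_map, localIdele]
    exact RestrictedProduct.mulSingle_eq_of_ne (A := fun v : Place k F => v.integers) _ h
  · exact RestrictedProduct.single_eq_of_ne (A := fun v : Place k F => v.integers) _ h

theorem UnramifiedForms.apply_eq_apply (f : UnramifiedForms k F) {g h γ : AdelicGL2 k F}
    (hγ : γ ∈ principalGL2 k F) (hK : g⁻¹ * γ * h ∈ maxCompact k F) : f.1 g = f.1 h := by
  rw [← f.2.1 γ hγ h, ← f.2.2.1 _ hK g]
  group

theorem SameDoubleCoset.apply_eq (f : UnramifiedForms k F) {g h : AdelicGL2 k F}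
    (H : SameDoubleCoset g h) : f.1 g = f.1 h := by
  obtain ⟨γ, hγ, κ, hκ, z, hz, rfl⟩ := H
  rw [f.2.2.2 z hz, f.2.2.1 κ hκ, f.2.1 γ hγ]

theorem finite_valued_ne_one (z : (Adele k F)ˣ) :
    {w : Place k F | Valued.v (component w (z : Adele k F)) ≠ 1}.Finite := by
  have h1 := (z : Adele k F).eventually
  have h2 := ((z⁻¹ : (Adele k F)ˣ) : Adele k F).eventually
  have h : ∀ᶠ w in Filter.cofinite, Valued.v (component (k := k) w (z : Adele k F)) = 1 := by
    filter_upwards [h1, h2] with w hw1 hw2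
    have hm : Valued.v (component (k := k) w (z : Adele k F)) *
        Valued.v (component w ((z⁻¹ : (Adele k F)ˣ) : Adele k F)) = 1 := by
      rw [← map_mul, ← map_mul, Units.mul_inv, map_one, map_one]
    refine le_antisymm hw1 ?_
    calc (1 : w.ring.ValueGroup) = _ := hm.symm
      _ ≤ Valued.v (component w (z : Adele k F)) * 1 := mul_le_mul_right hw2 _
      _ = _ := mul_one _
  exact h

end LocalTheory

/-! ### Principal adeles and ideles of the curve -/

section CurveAdeles

variable {k : Type*} [Field k] {W : WeierstrassCurve.Affine k}
  [IsPrincipalIdealRing W.CoordinateRing]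

/-- The poles of `a / b` lie at infinity or above a prime factor of `b`, and each prime lies below
only one finite place. This makes the diagonal embedding land in the restricted product. -/
theorem finite_notMem_ring (r : W.FunctionField) :
    {w : Place k W.FunctionField | r ∉ w.ring}.Finite := by
  obtain ⟨a, b, hb, rfl⟩ := IsFractionRing.div_surjective (A := W.CoordinateRing) r
  have hb0 := nonZeroDivisors.ne_zero hb
  set c := algebraMap W.CoordinateRing W.FunctionField with hc
  have hsub : {w : Place k W.FunctionField | c a / c b ∉ w.ring} ⊆ {placeAtInfinity W} ∪
      ⋃ q ∈ {q | q ∈ UniqueFactorizationMonoid.factors b},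
        {w | w ≠ placeAtInfinity W ∧ Prime q ∧ w.ring.valuation (c q) < 1} := by
    intro w hw
    by_cases h : w = placeAtInfinity W
    · exact Or.inl h
    refine Or.inr ?_
    have hlt : w.ring.valuation (c b) < 1 := by
      by_contra hlt
      rw [not_lt] at hlt
      refine hw ?_
      rw [← w.ring.valuation_le_one_iff, map_div₀]
      exact div_le_one_of_le₀ ((valuation_algebraMap_le_one h a).trans hlt) zero_le
    obtain ⟨p, hp, hpd⟩ := exists_prime_dvd_iff h
    obtain ⟨q, hq, hpq⟩ := UniqueFactorizationMonoid.exists_mem_factors_of_dvd hb0 hp.irreducible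
      ((hpd b).mp hlt)
    simp only [Set.mem_iUnion]
    exact ⟨q, hq, h, UniqueFactorizationMonoid.prime_of_factor q hq, (hpd q).mpr hpq.dvd⟩
  refine ((Set.finite_singleton _).union
    (Set.Finite.biUnion (Multiset.finite_toSet _) ?_)).subset hsub
  intro q _
  refine Set.Subsingleton.finite ?_
  rintro w ⟨h, hq, hwq⟩ w' ⟨h', -, hwq'⟩
  by_contra hne
  exact absurd (valuation_eq_one_of_ne h h' (Ne.symm hne) hq hwq) hwq'.ne

variable (W) in
/-- The diagonal embedding of the function field in its adele ring. -/
def diagonal : W.FunctionField →+* Adele k W.FunctionField where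
  toFun x := ⟨fun w => w.embed x, by
    refine (finite_notMem_ring x).subset fun w hw hx => hw ?_
    change Valued.v (w.embed x) ≤ 1
    rw [w.valued_embed]
    exact (w.ring.valuation_le_one_iff _).mpr hx⟩
  map_one' := RestrictedProduct.ext _ _ fun w => map_one w.embed
  map_mul' x y := RestrictedProduct.ext _ _ fun w => map_mul w.embed x y
  map_zero' := RestrictedProduct.ext _ _ fun w => map_zero w.embed
  map_add' x y := RestrictedProduct.ext _ _ fun w => map_add w.embed x y

theorem map_component_diagonal (w : Place k W.FunctionField) (γ : GL (Fin 2) W.FunctionField) :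
    Matrix.GeneralLinearGroup.map (component w) (Matrix.GeneralLinearGroup.map (diagonal W) γ) =
      Matrix.GeneralLinearGroup.map w.embed γ := rfl

theorem map_diagonal_mem (γ : GL (Fin 2) W.FunctionField) :
    Matrix.GeneralLinearGroup.map (diagonal W) γ ∈ principalGL2 k W.FunctionField :=
  ⟨γ, fun _ => rfl⟩

/-- The class number is one: the valuations of an idele at the finite places are those of a
function. -/
theorem exists_valuation_eq_of_idele (z : (Adele k W.FunctionField)ˣ) :
    ∃ a : (W.FunctionField)ˣ, ∀ w : Place k W.FunctionField, w ≠ placeAtInfinity W →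
      Valued.v (component w (z : Adele k W.FunctionField)) = w.ring.valuation (a : W.FunctionField)
      := by
  classical
  -- A power of the prime generating the center of `w` has the right value at `w` and is a unit at
  -- all other finite places; the finitely many local corrections are then multiplied together.
  have hloc : ∀ w : Place k W.FunctionField, ∃ a : (W.FunctionField)ˣ, w ≠ placeAtInfinity W →
      Valued.v (component w (z : Adele k W.FunctionField)) =
        w.ring.valuation (a : W.FunctionField) ∧
      ∀ w', w' ≠ placeAtInfinity W → w' ≠ w → w'.ring.valuation (a : W.FunctionField) = 1 := by
    intro w
    by_cases hw : w = placeAtInfinity W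
    · exact ⟨1, fun h => absurd hw h⟩
    obtain ⟨p, hp, hpd⟩ := exists_prime_dvd_iff hw
    obtain ⟨r, hr⟩ := w.exists_valued_eq (component w (z : Adele k W.FunctionField))
    have hr0 : r ≠ 0 := by
      rintro rfl
      rw [map_zero, Valuation.zero_iff] at hr
      exact (z.isUnit.map (component w)).ne_zero hr
    obtain ⟨n, hn⟩ := exists_valuation_eq_zpow hw hpd hp hr0
    have hp0 : algebraMap W.CoordinateRing W.FunctionField p ≠ 0 := by simpa using hp.ne_zero
    refine ⟨Units.mk0 _ hp0 ^ n, fun _ => ⟨?_, fun w' hw' hne => ?_⟩⟩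
    · rw [hr, hn, Units.val_zpow_eq_zpow_val, map_zpow₀, Units.val_mk0]
    · rw [Units.val_zpow_eq_zpow_val, map_zpow₀, Units.val_mk0,
        valuation_eq_one_of_ne hw hw' hne hp ((hpd p).mpr dvd_rfl), one_zpow]
  choose a ha using hloc
  have hS := finite_valued_ne_one z
  refine ⟨∏ w ∈ hS.toFinset.erase (placeAtInfinity W), a w, fun w hw => ?_⟩
  rw [Units.coe_prod, map_prod]
  by_cases hwS : w ∈ hS.toFinset.erase (placeAtInfinity W)
  · rw [Finset.prod_eq_single_of_mem w hwS, (ha w hw).1]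
    intro w' hw'S hne
    exact (ha w' (Finset.ne_of_mem_erase hw'S)).2 w hw hne.symm
  · rw [Finset.prod_eq_one]
    · by_contra h
      exact hwS (Finset.mem_erase.mpr ⟨hw, hS.mem_toFinset.mpr h⟩)
    · intro w' hw'S
      exact (ha w' (Finset.ne_of_mem_erase hw'S)).2 w hw fun h => hwS (h ▸ hw'S)

end CurveAdeles

/-! ### Values at the place at infinity -/

section Infinity

variable {k : Type*} [Field k] {W : WeierstrassCurve.Affine k}

variable (W) in
/-- The valuation of `t⁻¹` at infinity. -/
def infValue : (placeAtInfinity W).ring.ValueGroup := poleValue (placeAtInfinity W)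

variable (W) in
theorem one_lt_infValue : 1 < infValue W := one_lt_poleValue (xFun_notMem_placeAtInfinity W)

variable (W) in
theorem infValue_ne_zero : infValue W ≠ 0 := (zero_lt_one.trans (one_lt_infValue W)).ne'

variable (W) in
theorem valuation_tFun : (placeAtInfinity W).ring.valuation (tFun W : W.FunctionField) =
    (infValue W)⁻¹ := by
  rw [infValue, poleValue, ← map_inv₀, inv_div, tFun, Units.val_div_eq_div_val]
  rfl

variable (W) in
theorem valuation_tFun_inv :
    (placeAtInfinity W).ring.valuation ((tFun W)⁻¹ : (W.FunctionField)ˣ) = infValue W := by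
  rw [Units.val_inv_eq_inv_val, map_inv₀, valuation_tFun, inv_inv]

variable (W) in
theorem valuation_tFun_sq :
    (placeAtInfinity W).ring.valuation (tFun W ^ 2 : (W.FunctionField)ˣ) = (infValue W)⁻¹ ^ 2 := by
  rw [Units.val_pow_eq_pow_val, map_pow, valuation_tFun]

variable (W) in
/-- The upper right entry of `t_ℓ`. -/
def tEntry (l : k) : W.FunctionField :=
  ((tFun W)⁻¹ : (W.FunctionField)ˣ) + algebraMap k W.FunctionField l * tFun W

theorem tVertex_eq_localAffineMatrix (l : k) :
    tVertex W l = localAffineMatrix (placeAtInfinity W) (tFun W ^ 2) (tEntry W l) := rfl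

variable (W) in
theorem valuation_tEntry (l : k) :
    (placeAtInfinity W).ring.valuation (tEntry W l) = infValue W := by
  have h1 := one_lt_infValue W
  rw [tEntry, Valuation.map_add_eq_of_lt_left, valuation_tFun_inv]
  rw [valuation_tFun_inv, map_mul, valuation_tFun]
  calc _ ≤ (infValue W)⁻¹ :=
        mul_le_of_le_one_left' ((placeAtInfinity W).valuation_algebraMap_le_one l)
    _ < 1 := inv_lt_one_of_one_lt₀ h1
    _ < _ := h1

/-- The pole order is at most one and never equals one, so a non-zero such element has pole order
zero. This gap separates the vertices `t_ℓ` from the other two. -/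
theorem eq_zero_or_valuation_eq_one {a : W.CoordinateRing}
    (ha : (placeAtInfinity W).ring.valuation (algebraMap _ W.FunctionField a) ≤ infValue W) :
    algebraMap _ W.FunctionField a = 0 ∨
      (placeAtInfinity W).ring.valuation (algebraMap _ W.FunctionField a) = 1 := by
  rcases eq_or_ne a 0 with rfl | h0
  · exact Or.inl (map_zero _)
  obtain ⟨n, hn⟩ := exists_poleDegree_eq_natCast h0
  have hv := valuation_eq_poleValue_pow (xFun_notMem_placeAtInfinity W) hn
  change _ = infValue W ^ n at hv
  have h1 : n ≠ 1 := by
    rintro rfl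
    exact poleDegree_ne_one a hn
  rw [hv] at ha
  have hle : n ≤ 1 := by
    rw [← pow_le_pow_iff_right₀ (one_lt_infValue W), pow_one]
    exact ha
  obtain rfl : n = 0 := by omega
  rw [hv, pow_zero]
  exact Or.inr rfl

/-- The function `x - ℓ`, as a unit. -/
def xSub (W : WeierstrassCurve.Affine k) (l : k) : (W.FunctionField)ˣ :=
  Units.mk0 (algebraMap W.CoordinateRing W.FunctionField
      (xCoord W - algebraMap k W.CoordinateRing l)) (by
    have h := poleDegree_xCoord_sub (W := W) l
    have h0 : xCoord W - algebraMap k W.CoordinateRing l ≠ 0 := by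
      intro h0
      rw [poleDegree_eq_bot.mpr h0] at h
      cases h
    exact (map_ne_zero_iff _ (IsFractionRing.injective W.CoordinateRing W.FunctionField)).mpr h0)

theorem val_xSub (l : k) : (xSub W l : W.FunctionField) = xFun W - algebraMap k _ l := by
  rw [xSub, Units.val_mk0, map_sub, ← IsScalarTower.algebraMap_apply]
  rfl

theorem valuation_xSub (l : k) :
    (placeAtInfinity W).ring.valuation (xSub W l : W.FunctionField) = infValue W ^ 2 :=
  valuation_eq_poleValue_pow (xFun_notMem_placeAtInfinity W) (poleDegree_xCoord_sub l)

theorem valuation_xSub_mul_tFun_sq (l : k) :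
    (placeAtInfinity W).ring.valuation ((xSub W l * tFun W ^ 2 : (W.FunctionField)ˣ)) = 1 := by
  rw [Units.val_mul, map_mul, valuation_xSub, valuation_tFun_sq, ← mul_pow,
    mul_inv_cancel₀ (infValue_ne_zero W), one_pow]

/-- The expansion of `y / (x - ℓ)` at infinity. -/
theorem yFun_sub_mem (l : k) :
    yFun W - xSub W l * tEntry W l ∈ (placeAtInfinity W).ring := by
  have hx0 := xFun_ne_zero W
  have hy0 := yFun_ne_zero W
  have hE := weierstrass_equation_fun (W := W)
  have hx := xFun_notMem_placeAtInfinity W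
  have hvx : (placeAtInfinity W).ring.valuation (xFun W) = infValue W ^ 2 := poleValue_sq hx
  have hvy : (placeAtInfinity W).ring.valuation (yFun W) = infValue W ^ 3 := poleValue_cube hx
  have h1 := (one_lt_infValue W).le
  have ht : ((tFun W : (W.FunctionField)ˣ) : W.FunctionField) = xFun W / yFun W := by
    rw [tFun, Units.val_div_eq_div_val]
    rfl
  have ht' : (((tFun W)⁻¹ : (W.FunctionField)ˣ) : W.FunctionField) = yFun W / xFun W := by
    rw [Units.val_inv_eq_inv_val, ht, inv_div]
  -- The left side is `l * (y ^ 2 - x ^ 3 + l * x ^ 2) / (x * y)`. The Weierstrass equation removes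
  -- `y ^ 2 - x ^ 3`, leaving a numerator of pole order at most `5`, the pole order of `x * y`.
  have key : yFun W - xSub W l * tEntry W l =
      (algebraMap k _ l * (algebraMap k _ (W.a₂ + l) * xFun W ^ 2 + algebraMap k _ W.a₄ * xFun W +
        algebraMap k _ W.a₆ * 1 - algebraMap k _ W.a₁ * (xFun W * yFun W)
        - algebraMap k _ W.a₃ * yFun W)) / (xFun W * yFun W) := by
    rw [val_xSub, tEntry, ht, ht', map_add]
    field_simp
    linear_combination (algebraMap k W.FunctionField l) * hE
  have hc : ∀ (c : k) (z : W.FunctionField) (n : ℕ), n ≤ 5 →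
      (placeAtInfinity W).ring.valuation z = infValue W ^ n →
      (placeAtInfinity W).ring.valuation (algebraMap k _ c * z) ≤ infValue W ^ 5 := by
    intro c z n hn hz
    rw [map_mul, hz]
    exact (mul_le_of_le_one_left' ((placeAtInfinity W).valuation_algebraMap_le_one c)).trans
      (pow_le_pow_right₀ h1 hn)
  rw [← ValuationSubring.valuation_le_one_iff, key, map_div₀, map_mul _ (xFun W), hvx, hvy,
    ← pow_add, map_mul]
  refine div_le_one_of_le₀ ((mul_le_of_le_one_left'
    ((placeAtInfinity W).valuation_algebraMap_le_one l)).trans ?_) zero_le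
  refine (placeAtInfinity W).ring.valuation.map_sub_le
    ((placeAtInfinity W).ring.valuation.map_sub_le
      ((placeAtInfinity W).ring.valuation.map_add_le
        ((placeAtInfinity W).ring.valuation.map_add_le ?_ ?_) ?_) ?_) ?_
  · exact hc _ _ 4 (by norm_num) (by rw [map_pow, hvx, ← pow_mul])
  · exact hc _ _ 2 (by norm_num) hvx
  · exact hc _ _ 0 (by norm_num) (by rw [map_one, pow_zero])
  · exact hc _ _ 5 (by norm_num) (by rw [map_mul, hvx, hvy, ← pow_add])
  · exact hc _ _ 3 (by norm_num) hvy

end Infinity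

/-! ### Vertices in the support -/

section Vertices

variable {k : Type*} [Field k] {W : WeierstrassCurve.Affine k}

/-- The entries in a relation as in `exists_of_sameDoubleCoset_tVertex`. -/
theorem entry_relation {γ : GL (Fin 2) W.FunctionField} {l : k}
    {κ : GL (Fin 2) (placeAtInfinity W).Completion} {z : ((placeAtInfinity W).Completion)ˣ}
    (h : Matrix.GeneralLinearGroup.map (placeAtInfinity W).embed γ =
      Matrix.GeneralLinearGroup.map (placeAtInfinity W).embed
        (affineMatrix (tFun W ^ 2) (tEntry W l)) * κ * Matrix.GeneralLinearGroup.scalar (Fin 2) z)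
    (j : Fin 2) :
    (placeAtInfinity W).embed (γ 0 j) =
      ((placeAtInfinity W).embed (tFun W ^ 2 : (W.FunctionField)ˣ) * κ 0 j +
        (placeAtInfinity W).embed (tEntry W l) * κ 1 j) * z ∧
    (placeAtInfinity W).embed (γ 1 j) = κ 1 j * z := by
  have hij : ∀ i, (placeAtInfinity W).embed (γ i j) =
      ((Matrix.GeneralLinearGroup.map (placeAtInfinity W).embed
        (affineMatrix (tFun W ^ 2) (tEntry W l)) * κ) i j) * z := by
    intro i
    have := congrArg (fun g : GL (Fin 2) (placeAtInfinity W).Completion => g i j) h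
    simp only [Matrix.GeneralLinearGroup.map_apply] at this
    rw [this, Units.val_mul _ (Matrix.GeneralLinearGroup.scalar (Fin 2) z),
      Matrix.GeneralLinearGroup.coe_scalar, Matrix.scalar_apply, Matrix.mul_diagonal]
  refine ⟨?_, ?_⟩
  · rw [hij, Units.val_mul, Matrix.mul_apply, Fin.sum_univ_two,
      Matrix.GeneralLinearGroup.map_apply, Matrix.GeneralLinearGroup.map_apply]
    simp [affineMatrix]
  · rw [hij, Units.val_mul, Matrix.mul_apply, Fin.sum_univ_two,
      Matrix.GeneralLinearGroup.map_apply, Matrix.GeneralLinearGroup.map_apply]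
    simp [affineMatrix]

theorem map_scalar_inv_mul_inv_mul {R S : Type*} [CommRing R] [CommRing S] (φ : R →+* S)
    {γ δ : GL (Fin 2) R} {τ κ : GL (Fin 2) S} {z : Sˣ} (a : Rˣ)
    (h : Matrix.GeneralLinearGroup.map φ γ * τ * κ * Matrix.GeneralLinearGroup.scalar (Fin 2) z =
      Matrix.GeneralLinearGroup.map φ δ) :
    Matrix.GeneralLinearGroup.map φ (Matrix.GeneralLinearGroup.scalar (Fin 2) a⁻¹ * γ⁻¹ * δ) =
      τ * κ * Matrix.GeneralLinearGroup.scalar (Fin 2) (z * Units.map (φ : R →* S) a⁻¹) := by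
  rw [map_mul, map_mul, ← h, Matrix.GeneralLinearGroup.map_scalar, mul_assoc, map_inv,
    Matrix.GeneralLinearGroup.scalar_commute, map_mul]
  simp only [mul_assoc, map_inv, inv_mul_cancel_left]

theorem map_embed_scalar_inv_mul_inv_mul {F : Type*} [Field F] [Algebra k F] {w : Place k F}
    {γ₀ τ κ : AdelicGL2 k F} {z : (Adele k F)ˣ} {γ δ : GL (Fin 2) F}
    (hγ : Matrix.GeneralLinearGroup.map (component w) γ₀ =
      Matrix.GeneralLinearGroup.map w.embed γ)
    (h : Matrix.GeneralLinearGroup.map (component w)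
      (γ₀ * τ * κ * Matrix.GeneralLinearGroup.scalar (Fin 2) z) =
      Matrix.GeneralLinearGroup.map w.embed δ) (a : Fˣ) :
    Matrix.GeneralLinearGroup.map w.embed
      (Matrix.GeneralLinearGroup.scalar (Fin 2) a⁻¹ * γ⁻¹ * δ) =
      Matrix.GeneralLinearGroup.map (component w) τ *
        Matrix.GeneralLinearGroup.map (component w) κ *
        Matrix.GeneralLinearGroup.scalar (Fin 2)
          (Units.map (component w : Adele k F →* w.Completion) z *
            Units.map (w.embed : F →* w.Completion) a⁻¹) := by
  apply map_scalar_inv_mul_inv_mul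
  rw [← hγ, ← h, map_mul, map_mul, map_mul, Matrix.GeneralLinearGroup.map_scalar]

theorem valued_component_mul_embed_inv {F : Type*} [Field F] [Algebra k F] (w : Place k F)
    (z : (Adele k F)ˣ) (a : Fˣ) :
    Valued.v ((Units.map (component w : Adele k F →* w.Completion) z *
      Units.map (w.embed : F →* w.Completion) a⁻¹ : (w.Completion)ˣ) : w.Completion) =
      Valued.v (component w (z : Adele k F)) * (w.ring.valuation (a : F))⁻¹ := by
  rw [Units.val_mul, map_mul, Units.coe_map, Units.coe_map, MonoidHom.coe_coe, MonoidHom.coe_coe,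
    w.valued_embed, Units.val_inv_eq_inv_val, map_inv₀]

theorem scalar_mem_localCompact {F : Type*} [Field F] [Algebra k F] {w : Place k F}
    {u : (w.Completion)ˣ} (hu : Valued.v (u : w.Completion) = 1) :
    Matrix.GeneralLinearGroup.scalar (Fin 2) u ∈ w.localCompact := by
  rw [mem_localCompact_iff]
  constructor
  · intro i j
    rw [Matrix.GeneralLinearGroup.coe_scalar, Matrix.scalar_apply, Matrix.diagonal_apply]
    split_ifs
    · exact hu.le
    · rw [map_zero]; exact zero_le
  · rw [Matrix.GeneralLinearGroup.coe_scalar, Matrix.scalar_apply, Matrix.det_diagonal,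
      Fin.prod_univ_two, map_mul, hu, mul_one]

theorem notMem_localCompact {F : Type*} [Field F] [Algebra k F] {w : Place k F}
    {κ : GL (Fin 2) w.Completion} (h₁ : Valued.v (κ 1 1) < 1)
    (h₂ : Valued.v (κ 0 1) < 1 ∨ Valued.v (κ 1 0) < 1) : κ ∉ w.localCompact := by
  intro hκ
  obtain ⟨hle, hdet⟩ := mem_localCompact_iff.mp hκ
  rw [Matrix.det_fin_two] at hdet
  refine absurd hdet (ne_of_lt (Valuation.map_sub_lt _ ?_ ?_))
  · rw [map_mul]
    exact (mul_le_of_le_one_left' (hle 0 0)).trans_lt h₁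
  · rw [map_mul]
    rcases h₂ with h₂ | h₂
    · exact (mul_le_of_le_one_right' (hle 1 0)).trans_lt h₂
    · exact (mul_le_of_le_one_left' (hle 0 1)).trans_lt h₂

variable [IsPrincipalIdealRing W.CoordinateRing]

theorem exists_algebraMap_eq_of_mem_ringGL2 {γ : GL (Fin 2) W.FunctionField}
    (hγ : ∀ w : Place k W.FunctionField, w ≠ placeAtInfinity W → γ ∈ w.ringGL2) (i j : Fin 2) :
    ∃ a, algebraMap W.CoordinateRing W.FunctionField a = γ i j :=
  exists_algebraMap_eq_of_forall_mem fun w hw => (mem_ringGL2_iff.mp (hγ w hw)).1 i j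

/-- The determinants of `γ` and `γ⁻¹` are non-zero elements of the coordinate ring, so both have
value at least one at infinity, and their product is one. -/
theorem valuation_det_eq_one {γ : GL (Fin 2) W.FunctionField}
    (hγ : ∀ w : Place k W.FunctionField, w ≠ placeAtInfinity W → γ ∈ w.ringGL2) :
    (placeAtInfinity W).ring.valuation γ.1.det = 1 := by
  have key : ∀ δ : GL (Fin 2) W.FunctionField,
      (∀ w : Place k W.FunctionField, w ≠ placeAtInfinity W → δ ∈ w.ringGL2) →
      1 ≤ (placeAtInfinity W).ring.valuation δ.1.det := by
    intro δ hδ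
    obtain ⟨a, ha⟩ := exists_algebraMap_eq_of_forall_mem (r := δ.1.det) fun w hw =>
      (w.ring.valuation_le_one_iff _).mp (mem_ringGL2_iff.mp (hδ w hw)).2.le
    have h0 : a ≠ 0 := by
      rintro rfl
      rw [map_zero] at ha
      exact (Matrix.isUnits_det_units δ).ne_zero ha.symm
    obtain ⟨n, hn⟩ := exists_poleDegree_eq_natCast h0
    rw [← ha, valuation_eq_poleValue_pow (xFun_notMem_placeAtInfinity W) hn]
    exact one_le_pow₀ (one_lt_infValue W).le
  refine le_antisymm ?_ (key γ hγ)
  have h1 := key γ⁻¹ fun w hw => inv_mem (hγ w hw)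
  have h2 : (placeAtInfinity W).ring.valuation γ.1.det *
      (placeAtInfinity W).ring.valuation (γ⁻¹).1.det = 1 := by
    rw [← map_mul, ← Matrix.det_mul, ← Units.val_mul, mul_inv_cancel, Units.val_one,
      Matrix.det_one, map_one]
  calc (placeAtInfinity W).ring.valuation γ.1.det
      = (placeAtInfinity W).ring.valuation γ.1.det * 1 := (mul_one _).symm
    _ ≤ _ := mul_le_mul_right h1 _
    _ = 1 := h2

set_option maxHeartbeats 1000000 in
/-- An adelic matrix that is trivial at the finite places and is in the double coset of `t_ℓ` is
related to it by a matrix over the coordinate ring. -/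
theorem exists_of_sameDoubleCoset_tVertex {g : AdelicGL2 k W.FunctionField}
    {δ : GL (Fin 2) W.FunctionField}
    (hg : ∀ w : Place k W.FunctionField, w ≠ placeAtInfinity W →
      Matrix.GeneralLinearGroup.map (component w) g = 1)
    (hg' : Matrix.GeneralLinearGroup.map (component (placeAtInfinity W)) g =
      Matrix.GeneralLinearGroup.map (placeAtInfinity W).embed δ)
    {l : k} (H : SameDoubleCoset g (tVertex W l)) :
    ∃ γ : GL (Fin 2) W.FunctionField,
      (∀ w : Place k W.FunctionField, w ≠ placeAtInfinity W → γ ∈ w.ringGL2) ∧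
      ∃ κ ∈ (placeAtInfinity W).localCompact, ∃ z : ((placeAtInfinity W).Completion)ˣ,
        Matrix.GeneralLinearGroup.map (placeAtInfinity W).embed (γ * δ) =
          Matrix.GeneralLinearGroup.map (placeAtInfinity W).embed
            (affineMatrix (tFun W ^ 2) (tEntry W l)) * κ *
              Matrix.GeneralLinearGroup.scalar (Fin 2) z := by
  obtain ⟨γ₀, ⟨γ, hγ⟩, κ, hκ, _, ⟨z, rfl⟩, rfl⟩ := H
  -- By class number one the finite part of the central idele is a function times units; dividing by
  -- that function leaves a scalar that matters only at infinity.
  obtain ⟨a, ha⟩ := exists_valuation_eq_of_idele z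
  rw [mem_maxCompact_iff] at hκ
  refine ⟨Matrix.GeneralLinearGroup.scalar (Fin 2) a⁻¹ * γ⁻¹, fun w hw => ?_,
    Matrix.GeneralLinearGroup.map (component (placeAtInfinity W)) κ, hκ _,
    Units.map (component (placeAtInfinity W) : _ →* (placeAtInfinity W).Completion) z *
      Units.map ((placeAtInfinity W).embed : _ →* (placeAtInfinity W).Completion) a⁻¹, ?_⟩
  · have h := map_embed_scalar_inv_mul_inv_mul (hγ w) (δ := 1)
      ((hg w hw).trans (Matrix.GeneralLinearGroup.map_one w.embed).symm) a
    rw [tVertex_eq_localAffineMatrix, map_component_localAffineMatrix_of_ne hw, mul_one,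
      one_mul] at h
    rw [Place.ringGL2, Subgroup.mem_comap, h]
    refine mul_mem (hκ w) (scalar_mem_localCompact ?_)
    rw [valued_component_mul_embed_inv, ha w hw, mul_inv_cancel₀]
    simp
  · have h := map_embed_scalar_inv_mul_inv_mul (hγ (placeAtInfinity W)) hg' a
    rw [tVertex_eq_localAffineMatrix, map_component_localAffineMatrix_same] at h
    exact h

/-- The valuations of the determinants in a relation as in `exists_of_sameDoubleCoset_tVertex`. -/
theorem valuation_det_relation {γ δ : GL (Fin 2) W.FunctionField} {l : k}
    (hγ : ∀ w : Place k W.FunctionField, w ≠ placeAtInfinity W → γ ∈ w.ringGL2)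
    {κ : GL (Fin 2) (placeAtInfinity W).Completion} (hκ : κ ∈ (placeAtInfinity W).localCompact)
    {z : ((placeAtInfinity W).Completion)ˣ}
    (h : Matrix.GeneralLinearGroup.map (placeAtInfinity W).embed (γ * δ) =
      Matrix.GeneralLinearGroup.map (placeAtInfinity W).embed
        (affineMatrix (tFun W ^ 2) (tEntry W l)) * κ * Matrix.GeneralLinearGroup.scalar (Fin 2) z) :
    (placeAtInfinity W).ring.valuation δ.1.det =
      ((infValue W)⁻¹ * Valued.v (z : (placeAtInfinity W).Completion)) ^ 2 := by
  have hdet := congrArg (fun g : GL (Fin 2) (placeAtInfinity W).Completion => Valued.v g.1.det) h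
  simp only [Units.val_mul, Matrix.det_mul, map_mul] at hdet
  have hm : ∀ g : GL (Fin 2) W.FunctionField,
      (Matrix.GeneralLinearGroup.map (placeAtInfinity W).embed g).1.det =
        (placeAtInfinity W).embed g.1.det := fun g => (RingHom.map_det _ g.1).symm
  rw [hm, hm, hm, Place.valued_embed, Place.valued_embed, Place.valued_embed,
    valuation_det_eq_one hγ, one_mul, (mem_localCompact_iff.mp hκ).2, mul_one,
    Matrix.GeneralLinearGroup.coe_scalar, Matrix.scalar_apply, Matrix.det_diagonal,
    Fin.prod_univ_two, map_mul] at hdet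
  have ht : (affineMatrix (tFun W ^ 2) (tEntry W l)).1.det =
      ((tFun W ^ 2 : (W.FunctionField)ˣ) : W.FunctionField) := by
    simp [affineMatrix, Matrix.det_fin_two]
  rw [hdet, ht, valuation_tFun_sq, mul_pow, sq (Valued.v (z : (placeAtInfinity W).Completion))]

/-- The trivial vertex is not one of the vertices `t_ℓ`. -/
theorem not_sameDoubleCoset_one_tVertex (l : k) :
    ¬ SameDoubleCoset (1 : AdelicGL2 k W.FunctionField) (tVertex W l) := by
  intro H
  obtain ⟨γ, hγ, κ, hκ, z, h⟩ := exists_of_sameDoubleCoset_tVertex (δ := 1)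
    (fun w _ => map_one _) (by rw [map_one, map_one]) H
  have hdet := valuation_det_relation hγ hκ h
  rw [Units.val_one, Matrix.det_one, map_one, eq_comm,
    pow_eq_one_iff_of_nonneg zero_le two_ne_zero, inv_mul_eq_one₀ (infValue_ne_zero W)] at hdet
  rw [mul_one] at h
  -- Here `hdet` says that `z` has the value of `t⁻¹`. The lower entries `κ 1 j * z` of `γ` lie in
  -- the coordinate ring and are at most that large, hence zero or of value one; so the lower row of
  -- `κ` is not primitive.
  have key : ∀ j, Valued.v (κ 1 j) < 1 := by
    intro j
    have hv := congrArg Valued.v (entry_relation h j).2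
    rw [map_mul, ← hdet, Place.valued_embed] at hv
    obtain ⟨a, ha⟩ := exists_algebraMap_eq_of_mem_ringGL2 hγ 1 j
    have hle := (mem_localCompact_iff.mp hκ).1 1 j
    rcases eq_zero_or_valuation_eq_one (a := a) (by
      rw [ha, hv]; exact mul_le_of_le_one_left' hle) with h0 | h1
    · rw [← ha, h0, map_zero, eq_comm, mul_eq_zero] at hv
      rw [hv.resolve_right (infValue_ne_zero W)]
      exact zero_lt_one
    · rw [← ha, h1] at hv
      refine lt_of_le_of_ne hle fun h => ?_
      rw [h, one_mul] at hv
      exact (one_lt_infValue W).ne hv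
  exact notMem_localCompact (key 1) (Or.inr (key 0)) hκ

/-- The vertex `(t², 0; 0, 1)` is not one of the vertices `t_ℓ`. -/
theorem not_sameDoubleCoset_tFun_sq_tVertex (l : k) :
    ¬ SameDoubleCoset (localAffineMatrix (placeAtInfinity W) (tFun W ^ 2) 0) (tVertex W l) := by
  intro H
  obtain ⟨γ, hγ, κ, hκ, z, h⟩ := exists_of_sameDoubleCoset_tVertex
    (fun w hw => map_component_localAffineMatrix_of_ne hw _ _)
    (map_component_localAffineMatrix_same _ _ _) H
  have hdet := valuation_det_relation hγ hκ h
  have ht : (affineMatrix (tFun W ^ 2) (0 : W.FunctionField)).1.det =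
      ((tFun W ^ 2 : (W.FunctionField)ˣ) : W.FunctionField) := by
    simp [affineMatrix, Matrix.det_fin_two]
  have hT := one_lt_infValue W
  have hT0 := infValue_ne_zero W
  rw [ht, valuation_tFun_sq, pow_left_inj₀ zero_le zero_le two_ne_zero, eq_comm,
    mul_eq_left₀ (inv_ne_zero hT0)] at hdet
  have hcol : ∀ i, (γ * affineMatrix (tFun W ^ 2) 0 : GL (Fin 2) W.FunctionField) i 1 = γ i 1 := by
    intro i
    rw [Units.val_mul, Matrix.mul_apply, Fin.sum_univ_two]
    simp [affineMatrix]
  obtain ⟨h0, h1⟩ := entry_relation h 1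
  rw [hcol] at h0 h1
  have hv0 := congrArg Valued.v h0
  have hv1 := congrArg Valued.v h1
  rw [map_mul, hdet, mul_one, Place.valued_embed] at hv0 hv1
  have hle := (mem_localCompact_iff.mp hκ).1
  obtain ⟨a, ha⟩ := exists_algebraMap_eq_of_mem_ringGL2 hγ 0 1
  obtain ⟨b, hb⟩ := exists_algebraMap_eq_of_mem_ringGL2 hγ 1 1
  have hA : Valued.v ((placeAtInfinity W).embed (tFun W ^ 2 : (W.FunctionField)ˣ) * κ 0 1) < 1 := by
    rw [map_mul, Place.valued_embed, valuation_tFun_sq]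
    exact (mul_le_of_le_one_right' (hle 0 1)).trans_lt
      (pow_lt_one₀ zero_le (inv_lt_one_of_one_lt₀ hT) two_ne_zero)
  have hB : Valued.v ((placeAtInfinity W).embed (tEntry W l) * κ 1 1) =
      infValue W * Valued.v (κ 1 1) := by
    rw [map_mul, Place.valued_embed, valuation_tEntry]
  have hval : ∀ c : W.CoordinateRing, (placeAtInfinity W).ring.valuation
      (algebraMap _ W.FunctionField c) < 1 → algebraMap _ W.FunctionField c = 0 := fun c hc =>
    (eq_zero_or_valuation_eq_one (hc.le.trans hT.le)).resolve_right hc.ne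
  -- Now `z` has value one. If the lower entry `b` vanishes, so does `κ 1 1`; the upper entry then
  -- has value below one, so it vanishes too, and `κ` has a zero column.
  rcases eq_zero_or_valuation_eq_one (a := b) (by
    rw [hb, hv1]; exact (hle 1 1).trans hT.le) with hb0 | hb1
  · have hκ11 : κ 1 1 = 0 := by
      rw [← hb, hb0, map_zero, eq_comm, Valuation.zero_iff] at hv1
      exact hv1
    rw [hκ11, mul_zero, add_zero] at hv0
    have ha0 := hval a (by rw [ha, hv0]; exact hA)
    rw [← ha, ha0, map_zero, eq_comm, Valuation.zero_iff, mul_eq_zero] at hv0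
    have hκ01 : κ 0 1 = 0 := hv0.resolve_left (by simp)
    refine notMem_localCompact ?_ (Or.inl ?_) hκ
    · rw [hκ11, map_zero]; exact zero_lt_one
    · rw [hκ01, map_zero]; exact zero_lt_one
  -- If `b` has value one, the term with `t⁻¹ + ℓ t` dominates, and the upper entry would have a
  -- pole of order exactly one.
  · rw [← hb, hb1] at hv1
    rw [← hv1, mul_one] at hB
    rw [Valuation.map_add_eq_of_lt_right _ (by rw [hB]; exact hA.trans hT), hB] at hv0
    rcases eq_zero_or_valuation_eq_one (a := a) (by rw [ha, hv0]) with ha0 | ha1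
    · rw [← ha, ha0, map_zero] at hv0
      exact hT0 hv0.symm
    · rw [← ha, ha1] at hv0
      exact hT.ne hv0

end Vertices

/-! ### Translating vertices at a finite place to infinity -/

section Transfer

variable {k : Type*} [Field k] {W : WeierstrassCurve.Affine k}

theorem affineMatrix_inv {R : Type*} [CommRing R] (a : Rˣ) (b : R) :
    (affineMatrix a b)⁻¹ = affineMatrix a⁻¹ (-(((a⁻¹ : Rˣ) : R) * b)) := by
  rw [inv_eq_iff_mul_eq_one, affineMatrix_mul, ← affineMatrix_one_zero]
  congr 1
  · exact mul_inv_cancel a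
  · rw [mul_neg, Units.mul_inv_cancel_left, neg_add_cancel]

theorem yFun_mem {w : Place k W.FunctionField} (hw : w ≠ placeAtInfinity W) :
    yFun W ∈ w.ring :=
  algebraMap_coordinateRing_mem hw (yCoord W)

variable [IsPrincipalIdealRing W.CoordinateRing]

/-- The matrix `γ` agrees with the given vertex at `P` modulo `GL₂(𝒪_P)`, is integral at the other
finite places, and moves the new vertex at infinity into the maximal compact subgroup. -/
theorem apply_localAffineMatrix_eq (f : UnramifiedForms k W.FunctionField)
    {P : Place k W.FunctionField} (hP : P ≠ placeAtInfinity W) {a a' : (W.FunctionField)ˣ}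
    {b b' : W.FunctionField} {γ : GL (Fin 2) W.FunctionField}
    (h₁ : (affineMatrix a b)⁻¹ * γ ∈ P.ringGL2)
    (h₂ : γ * affineMatrix a' b' ∈ (placeAtInfinity W).ringGL2)
    (h₃ : ∀ w : Place k W.FunctionField, w ≠ placeAtInfinity W → w ≠ P → γ ∈ w.ringGL2) :
    f.1 (localAffineMatrix P a b) = f.1 (localAffineMatrix (placeAtInfinity W) a' b') := by
  refine UnramifiedForms.apply_eq_apply f (map_diagonal_mem γ) (mem_maxCompact_iff.mpr fun w => ?_)
  rw [map_mul, map_mul, map_inv, map_component_diagonal]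
  by_cases hwP : w = P
  · subst hwP
    rw [map_component_localAffineMatrix_same, map_component_localAffineMatrix_of_ne hP, mul_one,
      ← map_inv, ← map_mul]
    exact h₁
  rw [map_component_localAffineMatrix_of_ne hwP, inv_one, one_mul]
  by_cases hw : w = placeAtInfinity W
  · subst hw
    rw [map_component_localAffineMatrix_same, ← map_mul]
    exact h₂
  · rw [map_component_localAffineMatrix_of_ne hw, mul_one]
    exact h₃ w hw hwP


theorem valuation_xSub_eq_one (hW : ∀ x y : k, ¬ W.Equation x y) {P : Place k W.FunctionField}
    (hP : P ≠ placeAtInfinity W) {l : k}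
    (hl : P.ring.valuation (xSub W l : W.FunctionField) < 1) {w : Place k W.FunctionField}
    (hw : w ≠ placeAtInfinity W) (hwP : w ≠ P) :
    w.ring.valuation (xSub W l : W.FunctionField) = 1 :=
  valuation_eq_one_of_ne hP hw hwP (prime_xCoord_sub hW l) hl

theorem apply_localAffineMatrix_of_rational (hW : ∀ x y : k, ¬ W.Equation x y)
    (f : UnramifiedForms k W.FunctionField) {P : Place k W.FunctionField}
    (hP : P ≠ placeAtInfinity W) {l : k}
    (hl : P.ring.valuation (xSub W l : W.FunctionField) < 1) (c : k) :
    f.1 (localAffineMatrix P (xSub W l) (algebraMap k _ c)) =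
      f.1 (localAffineMatrix (placeAtInfinity W) (tFun W ^ 2) 0) := by
  -- A constant `c` is integral at infinity too, and `(x - ℓ) * t ^ 2` is a unit there, so the same
  -- matrix can be used globally.
  refine apply_localAffineMatrix_eq f hP (γ := affineMatrix (xSub W l) (algebraMap k _ c)) ?_ ?_ ?_
  · rw [inv_mul_cancel]
    exact one_mem _
  · rw [affineMatrix_mul, mul_zero, zero_add]
    exact affineMatrix_mem_ringGL2 (valuation_xSub_mul_tFun_sq l)
      ((placeAtInfinity W).algebraMap_mem c)
  · intro w hw hwP
    exact affineMatrix_mem_ringGL2 (valuation_xSub_eq_one hW hP hl hw hwP) (w.algebraMap_mem c)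

theorem apply_localAffineMatrix_of_irrational (hW : ∀ x y : k, ¬ W.Equation x y)
    (f : UnramifiedForms k W.FunctionField) {P : Place k W.FunctionField}
    (hP : P ≠ placeAtInfinity W) {l : k}
    (hl : P.ring.valuation (xSub W l : W.FunctionField) < 1) (c : k) {d : k} (hd : d ≠ 0) :
    f.1 (localAffineMatrix P (xSub W l) (algebraMap k _ c + algebraMap k _ d * yFun W)) =
      f.1 (tVertex W l) := by
  have hd' : algebraMap k W.FunctionField (-d) ≠ 0 := by simpa using hd
  have hdv : ∀ w : Place k W.FunctionField,
      w.ring.valuation (Units.mk0 _ hd' : (W.FunctionField)ˣ) = 1 := fun w =>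
    w.valuation_algebraMap (neg_ne_zero.mpr hd)
  rw [tVertex_eq_localAffineMatrix]
  -- The factor `-d` makes the poles at infinity cancel: the upper right entry becomes `c + d * (y -
  -- (x - ℓ) * (t⁻¹ + ℓ t))`, which is integral by the expansion of `y`. Hence the vertex depends on
  -- neither `c` nor `d`.
  refine apply_localAffineMatrix_eq f hP (γ := affineMatrix (xSub W l)
    (algebraMap k _ c + algebraMap k _ d * yFun W) * affineMatrix (Units.mk0 _ hd') 0) ?_ ?_ ?_
  · rw [inv_mul_cancel_left]
    exact affineMatrix_mem_ringGL2 (hdv P) (zero_mem _)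
  · rw [affineMatrix_mul, affineMatrix_mul, mul_zero, zero_add]
    refine affineMatrix_mem_ringGL2 ?_ ?_
    · rw [mul_right_comm, Units.val_mul, map_mul, valuation_xSub_mul_tFun_sq, hdv, mul_one]
    · have h : ((xSub W l * Units.mk0 _ hd' : (W.FunctionField)ˣ) : W.FunctionField) * tEntry W l +
          (algebraMap k _ c + algebraMap k _ d * yFun W) =
          algebraMap k _ c + algebraMap k _ d * (yFun W - xSub W l * tEntry W l) := by
        rw [Units.val_mul, Units.val_mk0, map_neg]
        ring
      rw [h]
      exact add_mem ((placeAtInfinity W).algebraMap_mem c)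
        (mul_mem ((placeAtInfinity W).algebraMap_mem d) (yFun_sub_mem l))
  · intro w hw hwP
    exact mul_mem (affineMatrix_mem_ringGL2 (valuation_xSub_eq_one hW hP hl hw hwP)
      (add_mem (w.algebraMap_mem c) (mul_mem (w.algebraMap_mem d) (yFun_mem hw))))
      (affineMatrix_mem_ringGL2 (hdv w) (zero_mem _))

end Transfer

/-! ### A Hecke operator of degree two -/

section Hecke

variable {k F : Type*} [Field k] [Field F] [Algebra k F]

variable (k F) in
/-- The Weyl element, embedded in `GL₂(𝔸)`. -/
def weyl : AdelicGL2 k F := Matrix.GeneralLinearGroup.swap (Adele k F) 0 1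

theorem map_component_weyl (w : Place k F) :
    Matrix.GeneralLinearGroup.map (component w) (weyl k F) =
      Matrix.GeneralLinearGroup.swap w.Completion 0 1 :=
  Matrix.GeneralLinearGroup.map_swap _ _ _

theorem weyl_mem_principalGL2 : weyl k F ∈ principalGL2 k F :=
  ⟨Matrix.GeneralLinearGroup.swap F 0 1, fun w => by
    rw [map_component_weyl, Matrix.GeneralLinearGroup.map_swap]⟩

theorem swap_eq {R : Type*} [CommRing R] :
    (Matrix.GeneralLinearGroup.swap R (0 : Fin 2) 1 : Matrix (Fin 2) (Fin 2) R) =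
      !![0, 1; 1, 0] := by
  ext i j
  fin_cases i <;> fin_cases j <;> simp [Matrix.swap, PEquiv.toMatrix_apply]

theorem weyl_mem_maxCompact : weyl k F ∈ maxCompact k F := by
  rw [mem_maxCompact_iff]
  intro w
  rw [map_component_weyl, mem_localCompact_iff, swap_eq]
  constructor
  · intro i j
    fin_cases i <;> fin_cases j <;> simp
  · simp [Matrix.det_fin_two]

/-- The characteristic function of the double coset `K h K`. -/
def HeckeAlgebra.indicator (h : AdelicGL2 k F) (s : Set (AdelicGL2 k F)) (hs : s.Finite)
    (hcover : ∀ κ ∈ maxCompact k F, ∃ r ∈ s, r⁻¹ * (κ * h) ∈ maxCompact k F) :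
    HeckeAlgebra k F :=
  ⟨Set.indicator {g | ∃ κ ∈ maxCompact k F, ∃ κ' ∈ maxCompact k F, g = κ * h * κ'} 1, by
    classical
    refine ⟨fun κ hκ g => ?_, fun κ hκ g => ?_, ?_⟩
    · simp only [Set.indicator_apply]
      refine if_congr ⟨?_, ?_⟩ rfl rfl
      · rintro ⟨κ₁, h₁, κ₂, h₂, hg⟩
        refine ⟨κ⁻¹ * κ₁, mul_mem (inv_mem hκ) h₁, κ₂, h₂, ?_⟩
        rw [mul_assoc, mul_assoc, ← mul_assoc κ₁, ← hg, inv_mul_cancel_left]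
      · rintro ⟨κ₁, h₁, κ₂, h₂, rfl⟩
        exact ⟨κ * κ₁, mul_mem hκ h₁, κ₂, h₂, by simp only [mul_assoc]⟩
    · simp only [Set.indicator_apply]
      refine if_congr ⟨?_, ?_⟩ rfl rfl
      · rintro ⟨κ₁, h₁, κ₂, h₂, hg⟩
        refine ⟨κ₁, h₁, κ₂ * κ⁻¹, mul_mem h₂ (inv_mem hκ), ?_⟩
        rw [← mul_assoc, ← hg, mul_inv_cancel_right]
      · rintro ⟨κ₁, h₁, κ₂, h₂, rfl⟩
        exact ⟨κ₁, h₁, κ₂ * κ, mul_mem h₂ hκ, by simp only [mul_assoc]⟩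
    · refine (hs.image QuotientGroup.mk).subset ?_
      rintro _ ⟨g, hg, rfl⟩
      obtain ⟨κ, hκ, κ', hκ', rfl⟩ := Set.mem_of_indicator_ne_zero hg
      obtain ⟨r, hr, hrκ⟩ := hcover κ hκ
      refine ⟨r, hr, QuotientGroup.eq.mpr ?_⟩
      rw [← mul_assoc]
      exact mul_mem hrκ hκ'⟩

/-- If the values of `f` on representatives of the cosets in `K h K` are `0` or `a`, and at least
one of them is `a`, then the corresponding Hecke operator takes a positive multiple of the value `a`
at `1`. -/
theorem heckeAction_indicator_one {h : AdelicGL2 k F} {s : Set (AdelicGL2 k F)} {hs : s.Finite}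
    {hcover : ∀ κ ∈ maxCompact k F, ∃ r ∈ s, r⁻¹ * (κ * h) ∈ maxCompact k F}
    (f : UnramifiedForms k F) {a : ℂ} (hf : ∀ r ∈ s, f.1 r = 0 ∨ f.1 r = a)
    {κ : AdelicGL2 k F} (hκ : κ ∈ maxCompact k F) (hκa : f.1 (κ * h) = a) :
    ∃ n : ℕ, n ≠ 0 ∧ heckeAction (HeckeAlgebra.indicator h s hs hcover) f 1 = n * a := by
  classical
  set Φ := HeckeAlgebra.indicator h s hs hcover
  have hmem : ∀ g, Φ.1 g ≠ 0 → Φ.1 g = 1 ∧ (f.1 g = 0 ∨ f.1 g = a) := by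
    intro g hg
    have hgD := Set.mem_of_indicator_ne_zero hg
    refine ⟨Set.indicator_of_mem hgD 1, ?_⟩
    obtain ⟨κ₁, h₁, κ₂, h₂, rfl⟩ := hgD
    obtain ⟨r, hr, hrκ⟩ := hcover κ₁ h₁
    have hfr := f.2.2.1 _ hrκ r
    rw [mul_inv_cancel_left] at hfr
    rw [f.2.2.1 κ₂ h₂, hfr]
    exact hf r hr
  unfold heckeAction
  set Ψ : AdelicGL2 k F ⧸ maxCompact k F → ℂ := fun c =>
    Quotient.liftOn' c (fun h => Φ.1 h * f.1 (1 * h)) _ with hΨ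
  have hΨmk : ∀ g : AdelicGL2 k F, Ψ (QuotientGroup.mk g) = Φ.1 g * f.1 g := by
    intro g
    change Φ.1 g * f.1 (1 * g) = _
    rw [one_mul]
  have hval : ∀ c, Ψ c ≠ 0 → Ψ c = a := by
    intro c
    induction c using QuotientGroup.induction_on with
    | H g =>
      intro hc
      rw [hΨmk] at hc ⊢
      obtain ⟨h1, h2⟩ := hmem g (left_ne_zero_of_mul hc)
      rw [h1, one_mul]
      exact h2.resolve_left (right_ne_zero_of_mul hc)
  -- For `a = 0` every summand is zero and any positive `n` will do. Otherwise `n` counts the cosets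
  -- with a non-zero summand, so the exact number of representatives is irrelevant.
  rcases eq_or_ne a 0 with rfl | ha
  · refine ⟨1, one_ne_zero, ?_⟩
    rw [mul_zero]
    refine finsum_eq_zero_of_forall_eq_zero fun c => ?_
    by_contra hc
    exact hc (hval c hc)
  have hfin : (Function.support Ψ).Finite := by
    refine Φ.2.2.2.subset fun c hc => ?_
    induction c using QuotientGroup.induction_on with
    | H g =>
      rw [Function.mem_support, hΨmk] at hc
      exact ⟨g, left_ne_zero_of_mul hc, rfl⟩
  refine ⟨hfin.toFinset.card, ?_, ?_⟩
  · refine Finset.card_ne_zero_of_mem (a := QuotientGroup.mk (κ * h)) (hfin.mem_toFinset.mpr ?_)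
    rw [Function.mem_support, hΨmk, hκa]
    have hD : κ * h ∈ {g | ∃ κ ∈ maxCompact k F, ∃ κ' ∈ maxCompact k F, g = κ * h * κ'} :=
      ⟨κ, hκ, 1, one_mem _, (mul_one _).symm⟩
    have h1 : Φ.1 (κ * h) = 1 := Set.indicator_of_mem hD 1
    rw [h1, one_mul]
    exact ha
  · rw [finsum_eq_sum Ψ hfin, Finset.sum_congr rfl fun c hc => hval c (hfin.mem_toFinset.mp hc),
      Finset.sum_const, nsmul_eq_mul]

end Hecke

/-! ### Representatives of the cosets in the double coset -/

section Representatives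

variable {k : Type*} [Field k] {W : WeierstrassCurve.Affine k}

/-- Modulo `x - ℓ`, polynomials in `x` may be evaluated at `ℓ`. -/
theorem dvd_sub_add_mul_yCoord (l : k) (a : W.CoordinateRing) :
    ∃ c d : k, xCoord W - algebraMap k W.CoordinateRing l ∣
      a - (algebraMap k W.CoordinateRing c + algebraMap k W.CoordinateRing d * yCoord W) := by
  obtain ⟨p, q, rfl⟩ := exists_eq_aeval_add a
  have h : ∀ r : k[X], xCoord W - algebraMap k W.CoordinateRing l ∣
      Polynomial.aeval (xCoord W) r - algebraMap k W.CoordinateRing (r.eval l) := by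
    intro r
    have := map_dvd (Polynomial.aeval (xCoord W))
      (Polynomial.X_sub_C_dvd_sub_C_eval (a := l) (p := r))
    simpa using this
  refine ⟨p.eval l, q.eval l, ?_⟩
  have h2 := dvd_add (h p) ((h q).mul_right (yCoord W))
  convert h2 using 1
  ring

/-- The product `(π, β; 0, 1)⁻¹ κ (π, 0; 0, 1)`. -/
theorem affineMatrix_inv_mul_mul_affineMatrix {R : Type*} [CommRing R] (π : Rˣ) (β : R)
    (κ : GL (Fin 2) R) :
    (((affineMatrix π β)⁻¹ * (κ * affineMatrix π 0) : GL (Fin 2) R) : Matrix (Fin 2) (Fin 2) R) =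
      !![κ 0 0 - β * κ 1 0, ((π⁻¹ : Rˣ) : R) * (κ 0 1 - β * κ 1 1); κ 1 0 * π, κ 1 1] := by
  rw [affineMatrix_inv, Units.val_mul, Units.val_mul]
  ext i j
  fin_cases i <;> fin_cases j <;> simp [affineMatrix, Matrix.mul_apply, Fin.sum_univ_two]
  · linear_combination (κ 0 0 - β * κ 1 0) * π.inv_mul
  · ring

theorem det_inv_mul_mul {R : Type*} [CommRing R] (g κ h : GL (Fin 2) R)
    (hgh : g.1.det = h.1.det) : (g⁻¹ * (κ * h)).1.det = κ.1.det := by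
  have : Matrix.GeneralLinearGroup.det (g⁻¹ * (κ * h)) = Matrix.GeneralLinearGroup.det κ := by
    have hgh' : Matrix.GeneralLinearGroup.det g = Matrix.GeneralLinearGroup.det h := Units.ext hgh
    rw [map_mul, map_mul, map_inv, hgh', mul_comm, mul_assoc, mul_inv_cancel, mul_one]
  exact congrArg Units.val this

/-- The product `(1, 0; 0, π)⁻¹ κ (π, 0; 0, 1)`. -/
theorem swap_conj_inv_mul_mul_affineMatrix {R : Type*} [CommRing R] (π : Rˣ) (κ : GL (Fin 2) R) :
    (((Matrix.GeneralLinearGroup.swap R (0 : Fin 2) 1 * affineMatrix π 0 *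
      Matrix.GeneralLinearGroup.swap R 0 1)⁻¹ * (κ * affineMatrix π 0) : GL (Fin 2) R) :
        Matrix (Fin 2) (Fin 2) R) =
      !![κ 0 0 * π, κ 0 1; κ 1 0, ((π⁻¹ : Rˣ) : R) * κ 1 1] := by
  have hs : (Matrix.GeneralLinearGroup.swap R (0 : Fin 2) 1)⁻¹ =
      Matrix.GeneralLinearGroup.swap R 0 1 := rfl
  rw [mul_inv_rev, mul_inv_rev, hs, affineMatrix_inv, Units.val_mul, Units.val_mul, Units.val_mul,
    Units.val_mul, swap_eq]
  ext i j
  fin_cases i <;> fin_cases j <;> simp [affineMatrix, Matrix.mul_apply, Fin.sum_univ_two]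
  linear_combination (κ 1 0) * π.inv_mul

/-- In the explicit product only the upper right entry involves `π⁻¹`, and `h` is its integrality;
the determinant is that of `κ`. -/
theorem affineMatrix_inv_mul_mul_mem {F : Type*} [Field F] [Algebra k F] {w : Place k F} {π : Fˣ}
    {β : F} (hπ : w.ring.valuation (π : F) ≤ 1) (hβ : β ∈ w.ring) {κ : GL (Fin 2) w.Completion}
    (hκ : κ ∈ w.localCompact)
    (h : Valued.v (κ 0 1 - w.embed β * κ 1 1) ≤ w.ring.valuation (π : F)) :
    (Matrix.GeneralLinearGroup.map w.embed (affineMatrix π β))⁻¹ *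
      (κ * Matrix.GeneralLinearGroup.map w.embed (affineMatrix π 0)) ∈ w.localCompact := by
  obtain ⟨hle, hdet⟩ := mem_localCompact_iff.mp hκ
  have hπ0 : w.ring.valuation (π : F) ≠ 0 := by simp
  rw [map_affineMatrix, map_affineMatrix, map_zero, mem_localCompact_iff,
    det_inv_mul_mul _ _ _ (by simp [affineMatrix, Matrix.det_fin_two]),
    affineMatrix_inv_mul_mul_affineMatrix]
  refine ⟨fun i j => ?_, hdet⟩
  fin_cases i <;> fin_cases j
  · refine Valuation.map_sub_le _ (hle 0 0) ?_
    rw [map_mul, w.valued_embed]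
    exact mul_le_one' ((w.ring.valuation_le_one_iff _).mpr hβ) (hle 1 0)
  · change Valued.v (((Units.map (w.embed : F →* w.Completion) π)⁻¹).val *
      (κ 0 1 - w.embed β * κ 1 1)) ≤ 1
    rw [map_mul, Units.val_inv_eq_inv_val, map_inv₀, Units.coe_map, MonoidHom.coe_coe,
      w.valued_embed]
    exact (inv_mul_le_one₀ (zero_lt_iff.mpr hπ0)).mpr h
  · change Valued.v (κ 1 0 * (Units.map (w.embed : F →* w.Completion) π).val) ≤ 1
    rw [map_mul, Units.coe_map, MonoidHom.coe_coe, w.valued_embed]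
    exact mul_le_one' (hle 1 0) hπ
  · exact hle 1 1

theorem swap_conj_inv_mul_mul_mem {F : Type*} [Field F] [Algebra k F] {w : Place k F} {π : Fˣ}
    (hπ : w.ring.valuation (π : F) ≤ 1) {κ : GL (Fin 2) w.Completion} (hκ : κ ∈ w.localCompact)
    (h : Valued.v (κ 1 1) ≤ w.ring.valuation (π : F)) :
    (Matrix.GeneralLinearGroup.swap w.Completion 0 1 *
      Matrix.GeneralLinearGroup.map w.embed (affineMatrix π 0) *
      Matrix.GeneralLinearGroup.swap w.Completion 0 1)⁻¹ *
      (κ * Matrix.GeneralLinearGroup.map w.embed (affineMatrix π 0)) ∈ w.localCompact := by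
  obtain ⟨hle, hdet⟩ := mem_localCompact_iff.mp hκ
  have hπ0 : w.ring.valuation (π : F) ≠ 0 := by simp
  rw [map_affineMatrix, map_zero, mem_localCompact_iff,
    det_inv_mul_mul _ _ _ (by
      rw [Units.val_mul, Units.val_mul, Matrix.det_mul, Matrix.det_mul, swap_eq]
      simp [affineMatrix, Matrix.det_fin_two]),
    swap_conj_inv_mul_mul_affineMatrix]
  refine ⟨fun i j => ?_, hdet⟩
  fin_cases i <;> fin_cases j
  · change Valued.v (κ 0 0 * (Units.map (w.embed : F →* w.Completion) π).val) ≤ 1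
    rw [map_mul, Units.coe_map, MonoidHom.coe_coe, w.valued_embed]
    exact mul_le_one' (hle 0 0) hπ
  · exact hle 0 1
  · exact hle 1 0
  · change Valued.v (((Units.map (w.embed : F →* w.Completion) π)⁻¹).val * κ 1 1) ≤ 1
    rw [map_mul, Units.val_inv_eq_inv_val, map_inv₀, Units.coe_map, MonoidHom.coe_coe,
      w.valued_embed]
    exact (inv_mul_le_one₀ (zero_lt_iff.mpr hπ0)).mpr h

/-- The quotient is the unipotent matrix `(1, b; 0, 1)` at `P`. This exhibits a representative with
value `f(t_ℓ)` inside the double coset. -/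
theorem localAffineMatrix_eq_mul (P : Place k W.FunctionField) (a : (W.FunctionField)ˣ)
    {b : W.FunctionField} (hb : b ∈ P.ring) :
    ∃ κ ∈ maxCompact k W.FunctionField, localAffineMatrix P a b = κ * localAffineMatrix P a 0 := by
  refine ⟨localAffineMatrix P a b * (localAffineMatrix P a 0)⁻¹, mem_maxCompact_iff.mpr fun w => ?_,
    (inv_mul_cancel_right _ _).symm⟩
  rw [map_mul, map_inv]
  by_cases hwP : w = P
  · subst hwP
    rw [map_component_localAffineMatrix_same, map_component_localAffineMatrix_same, ← map_inv,
      ← map_mul, affineMatrix_inv, affineMatrix_mul, mul_zero, neg_zero, mul_zero, zero_add,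
      mul_inv_cancel]
    exact affineMatrix_mem_ringGL2 (by simp) hb
  · rw [map_component_localAffineMatrix_of_ne hwP, map_component_localAffineMatrix_of_ne hwP,
      inv_one, mul_one]
    exact one_mem _

variable [IsPrincipalIdealRing W.CoordinateRing]

/-- The residue field at the place above `x = ℓ` is generated by `1` and `y`. -/
theorem exists_valued_sub_lt_one (hW : ∀ x y : k, ¬ W.Equation x y) {P : Place k W.FunctionField}
    (hP : P ≠ placeAtInfinity W) {l : k}
    (hl : P.ring.valuation (xSub W l : W.FunctionField) < 1) {u : P.Completion}
    (hu : Valued.v u ≤ 1) :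
    ∃ c d : k, Valued.v (u - P.embed (algebraMap k _ c + algebraMap k _ d * yFun W)) < 1 := by
  have hprime := prime_xCoord_sub hW l
  have hdvd := valuation_lt_one_iff_dvd hP hprime hl
  obtain ⟨r, hr⟩ := P.exists_valued_sub_lt_one u
  have hrv : P.ring.valuation r ≤ 1 := by
    rw [← P.valued_embed, ← sub_sub_cancel u (P.embed r)]
    exact (Valuation.map_sub _ _ _).trans (max_le hu hr.le)
  obtain ⟨a, b, hb, rfl⟩ := (mem_ring_iff_exists hP hdvd hprime r).mp
    ((P.ring.valuation_le_one_iff r).mp hrv)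
  -- Bézout makes `t` an inverse of `b` modulo `x - ℓ`, so `a / b` is congruent to `a * t`, which
  -- can be reduced to `c + d * y`.
  obtain ⟨s, t, hst⟩ := (hprime.irreducible.coprime_iff_not_dvd.mpr hb)
  set ι := algebraMap W.CoordinateRing W.FunctionField with hι
  have hbv : P.ring.valuation (ι b) = 1 :=
    le_antisymm (valuation_algebraMap_le_one hP b) (not_lt.mp fun h => hb ((hdvd b).mp h))
  have hb0 : ι b ≠ 0 := by
    intro h
    rw [h, map_zero] at hbv
    exact zero_ne_one hbv
  obtain ⟨c, d, hcd⟩ := dvd_sub_add_mul_yCoord l (a * t)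
  refine ⟨c, d, ?_⟩
  have h1 : P.ring.valuation (ι a / ι b - ι (a * t)) < 1 := by
    have h : ι a / ι b - ι (a * t) =
        ι (a * s) * ι (xCoord W - algebraMap k W.CoordinateRing l) / ι b := by
      have hst' := congrArg ι hst
      simp only [map_add, map_mul, map_one] at hst' ⊢
      field_simp
      linear_combination -ι a * hst'
    rw [h, map_div₀, hbv, div_one, map_mul]
    exact (mul_le_of_le_one_left' (valuation_algebraMap_le_one hP _)).trans_lt hl
  have h2 : P.ring.valuation (ι (a * t) - (algebraMap k _ c + algebraMap k _ d * yFun W)) < 1 := by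
    have h := (hdvd _).mpr hcd
    rw [map_sub, map_add, map_mul _ _ (yCoord W), ← IsScalarTower.algebraMap_apply,
      ← IsScalarTower.algebraMap_apply] at h
    exact h
  have h3 : u - P.embed (algebraMap k _ c + algebraMap k _ d * yFun W) =
      (u - P.embed (ι a / ι b)) + (P.embed (ι a / ι b - ι (a * t)) +
        P.embed (ι (a * t) - (algebraMap k _ c + algebraMap k _ d * yFun W))) := by
    rw [← map_add, sub_add_sub_cancel, map_sub, sub_add_sub_cancel]
  rw [h3]
  refine Valuation.map_add_lt _ hr (Valuation.map_add_lt _ ?_ ?_)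
  · rw [P.valued_embed]; exact h1
  · rw [P.valued_embed]; exact h2

/-- The function `x - ℓ` is a uniformizer at `P`: values are integral powers of its value, and a
value below one has exponent at least one. -/
theorem valued_le_of_lt_one (hW : ∀ x y : k, ¬ W.Equation x y) {P : Place k W.FunctionField}
    (hP : P ≠ placeAtInfinity W) {l : k}
    (hl : P.ring.valuation (xSub W l : W.FunctionField) < 1) {u : P.Completion}
    (hu : Valued.v u < 1) : Valued.v u ≤ P.ring.valuation (xSub W l : W.FunctionField) := by
  have hprime := prime_xCoord_sub hW l
  obtain ⟨r, hr⟩ := P.exists_valued_eq u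
  rcases eq_or_ne r 0 with rfl | hr0
  · rw [hr, map_zero]; exact zero_le
  obtain ⟨n, hn⟩ := exists_valuation_eq_zpow hP (valuation_lt_one_iff_dvd hP hprime hl) hprime hr0
  change _ = P.ring.valuation (xSub W l : W.FunctionField) ^ n at hn
  have h0 : 0 < P.ring.valuation (xSub W l : W.FunctionField) := zero_lt_iff.mpr (by simp)
  rw [hr, hn] at hu ⊢
  have hn1 : 0 < n := by
    by_contra hn0
    refine absurd hu (not_lt.mpr ?_)
    exact one_le_zpow_of_nonpos₀ h0 hl.le (not_lt.mp hn0)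
  calc _ ≤ P.ring.valuation (xSub W l : W.FunctionField) ^ (1 : ℤ) :=
        zpow_le_zpow_right_of_le_one₀ h0 hl.le hn1
    _ = _ := zpow_one _

variable (W) in
/-- Representatives of the cosets in the double coset of `(x - ℓ, 0; 0, 1)` at `P`. -/
def cosetRepresentatives (P : Place k W.FunctionField) (l : k) :
    Set (AdelicGL2 k W.FunctionField) :=
  {weyl k W.FunctionField * localAffineMatrix P (xSub W l) 0 * weyl k W.FunctionField} ∪
    Set.range fun c : k × k =>
      localAffineMatrix P (xSub W l) (algebraMap k _ c.1 + algebraMap k _ c.2 * yFun W)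

-- The coset of `κ h` depends only on the second column of `κ` modulo the maximal ideal at `P`, as a
-- point of the projective line over the residue field. If `κ 1 1` is a unit the point is the
-- residue of `κ 0 1 / κ 1 1`; otherwise it is the point at infinity, given by the Weyl conjugate.
set_option maxHeartbeats 1000000 in
theorem exists_mem_cosetRepresentatives (hW : ∀ x y : k, ¬ W.Equation x y)
    {P : Place k W.FunctionField} (hP : P ≠ placeAtInfinity W) {l : k}
    (hl : P.ring.valuation (xSub W l : W.FunctionField) < 1)
    (κ : AdelicGL2 k W.FunctionField) (hκ : κ ∈ maxCompact k W.FunctionField) :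
    ∃ r ∈ cosetRepresentatives W P l,
      r⁻¹ * (κ * localAffineMatrix P (xSub W l) 0) ∈ maxCompact k W.FunctionField := by
  rw [mem_maxCompact_iff] at hκ
  have hle := (mem_localCompact_iff.mp (hκ P)).1
  by_cases h11 : Valued.v (Matrix.GeneralLinearGroup.map (component P) κ 1 1) = 1
  · have hne : Matrix.GeneralLinearGroup.map (component P) κ 1 1 ≠ 0 := by
      intro h
      rw [h, map_zero] at h11
      exact zero_ne_one h11
    obtain ⟨c, d, hcd⟩ := exists_valued_sub_lt_one hW hP hl
      (u := Matrix.GeneralLinearGroup.map (component P) κ 0 1 /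
        Matrix.GeneralLinearGroup.map (component P) κ 1 1) (by
      rw [map_div₀, h11, div_one]; exact hle 0 1)
    refine ⟨_, Or.inr ⟨(c, d), rfl⟩, mem_maxCompact_iff.mpr fun w => ?_⟩
    rw [map_mul, map_mul, map_inv]
    by_cases hwP : w = P
    · subst hwP
      rw [map_component_localAffineMatrix_same, map_component_localAffineMatrix_same]
      refine affineMatrix_inv_mul_mul_mem hl.le (add_mem (w.algebraMap_mem c)
        (mul_mem (w.algebraMap_mem d) (yFun_mem hP))) (hκ w) (valued_le_of_lt_one hW hP hl ?_)
      rw [div_sub' hne, map_div₀, h11, div_one, mul_comm] at hcd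
      exact hcd
    · rw [map_component_localAffineMatrix_of_ne hwP, map_component_localAffineMatrix_of_ne hwP,
        inv_one, one_mul, mul_one]
      exact hκ w
  · refine ⟨_, Or.inl rfl, mem_maxCompact_iff.mpr fun w => ?_⟩
    rw [map_mul, map_mul, map_inv, map_mul, map_mul, map_component_weyl]
    by_cases hwP : w = P
    · subst hwP
      rw [map_component_localAffineMatrix_same]
      exact swap_conj_inv_mul_mul_mem hl.le (hκ w)
        (valued_le_of_lt_one hW hP hl (lt_of_le_of_ne (hle 1 1) h11))
    · rw [map_component_localAffineMatrix_of_ne hwP, mul_one, mul_one]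
      have : Matrix.GeneralLinearGroup.swap w.Completion (0 : Fin 2) 1 *
          Matrix.GeneralLinearGroup.swap w.Completion 0 1 = 1 := mul_inv_cancel _
      rw [this, inv_one, one_mul]
      exact hκ w

end Representatives

/-! ### The main theorem -/

section Main

variable {k : Type*} [Field k] {W : WeierstrassCurve.Affine k}

/-- A Hecke eigenform with support in the vertices `t_ℓ` vanishes at `t_ℓ`: evaluate the Hecke
operator of a place of degree two above `x = ℓ` at the identity, where the eigenform is zero. The
neighbours of the identity are `t_ℓ` and a vertex outside the support. -/
theorem apply_tVertex_eq_zero [Finite k] (hW : ∀ x y : k, ¬ W.Equation x y)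
    (f : UnramifiedForms k W.FunctionField) (hH : IsHeckeEigenform f) (hT : SupportedOnT W f)
    (l : k) : f.1 (tVertex W l) = 0 := by
  have := isPrincipalIdealRing_coordinateRing hW
  obtain ⟨P, hP, hl⟩ := exists_place_of_prime (prime_xCoord_sub hW l)
  change P.ring.valuation (xSub W l : W.FunctionField) < 1 at hl
  have h1 : f.1 1 = 0 := by
    by_contra h
    obtain ⟨l', hl'⟩ := hT 1 h
    exact not_sameDoubleCoset_one_tVertex l' hl'
  have h2 : f.1 (localAffineMatrix (placeAtInfinity W) (tFun W ^ 2) 0) = 0 := by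
    by_contra h
    obtain ⟨l', hl'⟩ := hT _ h
    exact not_sameDoubleCoset_tFun_sq_tVertex l' hl'
  have hvals : ∀ r ∈ cosetRepresentatives W P l, f.1 r = 0 ∨ f.1 r = f.1 (tVertex W l) := by
    rintro r (rfl | ⟨⟨c, d⟩, rfl⟩)
    · left
      -- The Weyl element disappears on the right into the maximal compact subgroup and on the left
      -- into `GL₂(F)`; what remains is the representative with `c = d = 0`.
      rw [f.2.2.1 _ weyl_mem_maxCompact, f.2.1 _ weyl_mem_principalGL2, ← h2,
        ← apply_localAffineMatrix_of_rational hW f hP hl 0, map_zero]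
    · rcases eq_or_ne d 0 with rfl | hd
      · left
        dsimp only
        rw [map_zero, zero_mul, add_zero, apply_localAffineMatrix_of_rational hW f hP hl, h2]
      · exact Or.inr (apply_localAffineMatrix_of_irrational hW f hP hl c hd)
  have hfin : (cosetRepresentatives W P l).Finite :=
    (Set.finite_singleton _).union (Set.finite_range _)
  obtain ⟨κ, hκ, hκeq⟩ := localAffineMatrix_eq_mul P (xSub W l)
    (b := algebraMap k _ 0 + algebraMap k _ 1 * yFun W)
    (add_mem (P.algebraMap_mem 0) (mul_mem (P.algebraMap_mem 1) (yFun_mem hP)))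
  have hκf : f.1 (κ * localAffineMatrix P (xSub W l) 0) = f.1 (tVertex W l) := by
    rw [← hκeq]
    exact apply_localAffineMatrix_of_irrational hW f hP hl 0 one_ne_zero
  obtain ⟨n, hn, hsum⟩ := heckeAction_indicator_one
    (hs := hfin) (hcover := exists_mem_cosetRepresentatives hW hP hl) f hvals hκ hκf
  obtain ⟨c, hc⟩ := hH (HeckeAlgebra.indicator _ _ hfin (exists_mem_cosetRepresentatives hW hP hl))
  have h := hc 1
  rw [hsum, h1, mul_zero] at h
  exact (mul_eq_zero.mp h).resolve_left (Nat.cast_ne_zero.mpr hn)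

/-- Reduction by `z ^ q = z`. For `q = 2` the equation becomes `0 = 1`, and for `q = 3` it becomes
`y ^ 2 = -1`, which has no solution in a field of three elements. For `q = 4` both `y ^ 2 + y` and
`x ^ 3` are `0` or `1`, which forces `α` to be `0` or `1`. -/
theorem exists_notEquation_of_isOneOfThreeCurves (hW : IsOneOfThreeCurves W) :
    Finite k ∧ ∀ x y : k, ¬ W.Equation x y := by
  rcases hW with ⟨hk, rfl⟩ | ⟨hk, rfl⟩ | ⟨hk, α, hα0, hα1, rfl⟩
  · have hfin : Finite k := Nat.finite_of_card_ne_zero (by omega)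
    have := Fintype.ofFinite k
    rw [Nat.card_eq_fintype_card] at hk
    refine ⟨hfin, fun x y h => ?_⟩
    have hpow : ∀ z : k, z ^ 2 = z := fun z => hk ▸ FiniteField.pow_card z
    have h2 : (2 : k) = 0 := by linear_combination hpow 2
    rw [WeierstrassCurve.Affine.equation_iff] at h
    dsimp only at h
    refine one_ne_zero (α := k) ?_
    linear_combination -h + hpow y + y * h2 - (1 + x) * hpow x - x * h2
  · have hfin : Finite k := Nat.finite_of_card_ne_zero (by omega)
    have := Fintype.ofFinite k
    rw [Nat.card_eq_fintype_card] at hk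
    refine ⟨hfin, fun x y h => ?_⟩
    have hpow : ∀ z : k, z ^ 3 = z := fun z => hk ▸ FiniteField.pow_card z
    rw [WeierstrassCurve.Affine.equation_iff] at h
    dsimp only at h
    have hy : y ^ 2 = -1 := by linear_combination h + hpow x
    have hy2 : y * (-1 - 1) = 0 := by linear_combination hpow y - y * hy
    have h20 : (-1 - 1 : k) ≠ 0 := by
      intro h20
      have h3 := FiniteField.cast_card_eq_zero k
      rw [hk, Nat.cast_ofNat] at h3
      exact one_ne_zero (α := k) (by linear_combination h3 + h20)
    rw [(mul_eq_zero.mp hy2).resolve_right h20] at hy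
    exact one_ne_zero (α := k) (by linear_combination hy)
  · have hfin : Finite k := Nat.finite_of_card_ne_zero (by omega)
    have := Fintype.ofFinite k
    rw [Nat.card_eq_fintype_card] at hk
    refine ⟨hfin, fun x y h => ?_⟩
    have hpow : ∀ z : k, z ^ 4 = z := fun z => hk ▸ FiniteField.pow_card z
    rw [WeierstrassCurve.Affine.equation_iff] at h
    dsimp only at h
    have h4 : (4 : k) = 0 := by
      have := FiniteField.cast_card_eq_zero k
      rw [hk] at this
      exact_mod_cast this
    have h2 : (2 : k) = 0 := by
      have : (2 : k) * 2 = 0 := by linear_combination h4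
      exact (mul_self_eq_zero.mp this)
    set u := y ^ 2 + y with hu
    have hu2 : u * (u - 1) = 0 := by
      rw [hu]
      linear_combination hpow y + y ^ 3 * h2
    have hx : x ^ 3 * (x ^ 3 - 1) = 0 := by
      linear_combination x ^ 2 * hpow x
    have hα : α = u - x ^ 3 := by
      rw [hu]; linear_combination -h
    rcases mul_eq_zero.mp hu2 with h1 | h1 <;> rcases mul_eq_zero.mp hx with h3 | h3
    · exact hα0 (by rw [hα, h1, h3, sub_zero])
    · exact hα1 (by linear_combination hα + h1 - h3 - h2)
    · exact hα1 (by linear_combination hα + h1 - h3)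
    · exact hα0 (by linear_combination hα + h1 - h3)

end Main

end AutomorphicGL2

end

open AutomorphicGL2 in
theorem mainTheorem6 {k : Type*} [Field k] (W : WeierstrassCurve.Affine k)
    (hW : IsOneOfThreeCurves W) (f : UnramifiedForms k W.FunctionField) :
    (IsCuspForm f ∧ IsHeckeEigenform f ∧ SupportedOnT W f) ↔ f = 0 := by
  constructor
  · rintro ⟨-, hH, hT⟩
    obtain ⟨hfin, hpt⟩ := exists_notEquation_of_isOneOfThreeCurves hW
    refine Subtype.ext (funext fun g => ?_)
    by_contra hg
    obtain ⟨l, hl⟩ := hT g hg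
    exact hg ((hl.apply_eq f).trans (apply_tVertex_eq_zero hpt f hH hT l))
  · rintro rfl
    refine ⟨fun μ _ g => ?_, fun Φ => ⟨0, fun g => ?_⟩, fun g hg => absurd rfl hg⟩
    · have h : unipotentTranslate (0 : UnramifiedForms k W.FunctionField) g = 0 := by
        funext c
        induction c using QuotientAddGroup.induction_on with
        | H x => rfl
      rw [h]
      exact MeasureTheory.integral_zero _ _
    · rw [zero_mul]
      refine finsum_eq_zero_of_forall_eq_zero fun c => ?_
      induction c using QuotientGroup.induction_on with
      | H x => exact mul_zero _
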